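/- **Setting.** Consider an $N$-player game in which player $i$ chooses $x^i\in\mathbb{R}^{d_i}$ and has loss $\ell^i(x)$, $x=(x^1,\dots,x^N)\in\mathcal X=\prod_i\mathbb{R}^{d_i}$ (Euclidean norms, $\|x\|^2=\sum_i\|x^i\|^2$). Write $V^i(x)=\nabla_{x^i}\ell^i(x)$ and $V=(V^i)_i$. A point $x_\star$ is a Nash equilibrium if $\ell^i(x_\star)\le\ell^i(y,x_\star^{-i})$ for all $i$ and $y\in\mathbb{R}^{d_i}$. Assume: 1. each $\ell^i$ is convex and differentiable in $x^i$, and each $V^i$ is $L$-Lipschitz on $\mathcal X$; 2. (variational stability) the set of Nash equilibria is non-empty and $\langle V(x),x-x_\star\rangle\ge0$ for every $x\in\mathcal X$ and every Nash equilibrium $x_\star$. At each round $t=1,2,\dots$ the joint action $X_{t+1/2}$ is played and player $i$ observes $g^i_t=V^i(X_{t+1/2})+\xi^i_t$; set $g^i_0=0$. Let $\mathcal F_t$ be the $\sigma$-algebra generated by $X_{3/2},\dots,X_{t+1/2}$. Assume further, for all $t\ge1$ and all $i$: 3. (multiplicative noise) $\mathbb E[\xi^i_t\mid\mathcal F_t]=0$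 and $\mathbb E[\|\xi^i_t\|^2\mid\mathcal F_t]\le\sigma_M^2\|V^i(X_{t+1/2})\|^2$ almost surely, for a constant $\sigma_M$; 4. (bounded feedback) $\|V^i(x)\|\le G$ for all $x\in\mathcal X$, and $\|\xi^i_t\|\le\bar\sigma$ almost surely, for constants $G,\bar\sigma$. Let $q\in(0,1/4]$, let $X_1$ be deterministic or, more generally, an almost surely bounded random vector, and let all players run adaptive OptDA+: for $t\ge1$, $$X^i_{t+1/2}=X^i_t-\gamma^i_t g^i_{t-1},\qquad X^i_{t+1}=X^i_1-\eta^i_{t+1}\sum_{s=1}^{t}g^i_s,$$ where, with $\lambda^i_t=\sum_{s=1}^{t}\|g^i_s\|^2$ and $\mu^i_t=\sum_{s=1}^{t}\|X^i_s-X^i_{s+1}\|^2$ (both $0$ for $t\le0$), $$\gamma^i_t=\frac{1}{(1+\lambda^i_{t-2})^{1/2-q}},\qquad \eta^i_t=\frac{1}{\sqrt{1+\lambda^i_{t-2}+\mu^i_{t-2}}}.$$ **Theorem.** Almost surely: - for every $i$, the sequences $(\lambda^i_t)_t$ and $(\mu^i_t)_t$ converge to finite limits, and the step sizes $(\gamma^i_t)_t$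 and $(\eta^i_t)_t$ converge to positive limits (the limits may be random); - $\sum_{t\ge1}\|V(X_{t+1/2})\|^2<\infty$; - $(X_t)_t$ and $(X_{t+1/2})_t$ both converge to the same (possibly random) Nash equilibrium. -/

import Mathlib

open MeasureTheory Filter Topology
open scoped NNReal

noncomputable section

namespace NoisyGame

/-- Player `i`'s action space, the Euclidean space of dimension `d i`. -/
abbrev Action {N : ℕ} (d : Fin N → ℕ) (i : Fin N) : Type := EuclideanSpace ℝ (Fin (d i))

/-- Joint actions `x = (xⁱ)ᵢ`, with `‖x‖² = ∑ᵢ ‖xⁱ‖²`. -/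
abbrev JointAction {N : ℕ} (d : Fin N → ℕ) : Type := PiLp 2 (fun i => Action d i)

section Game

variable {N : ℕ} {d : Fin N → ℕ}

/-- The joint action `(y, x⁻ⁱ)`: player `i` plays `y`, the others play as in `x`. -/
def deviate (x : JointAction d) (i : Fin N) (y : Action d i) : JointAction d :=
  WithLp.toLp 2 (Function.update (WithLp.ofLp x) i y)

/-- Nash equilibria of the game with losses `ℓ`. -/
def IsNash (ℓ : Fin N → JointAction d → ℝ) (x : JointAction d) : Prop :=
  ∀ (i : Fin N) (y : Action d i), ℓ i x ≤ ℓ i (deviate x i y)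

/-- The individual gradient `Vⁱ(x)`, i.e. the gradient of `ℓⁱ` in player `i`'s own action. -/
def indivGrad (ℓ : Fin N → JointAction d → ℝ) (i : Fin N) (x : JointAction d) : Action d i :=
  gradient (fun y => ℓ i (deviate x i y)) (x i)

/-- The joint vector field `V(x) = (Vⁱ(x))ᵢ`. -/
def jointGrad (ℓ : Fin N → JointAction d → ℝ) (x : JointAction d) : JointAction d :=
  WithLp.toLp 2 (fun i => indivGrad ℓ i x)

/-- Every loss is convex and differentiable in the player's own action, and every individual
gradient is `L`-Lipschitz in the joint action. -/
structure ConvexSmooth (ℓ : Fin N → JointAction d → ℝ) (L : ℝ≥0) : Prop where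
  convex : ∀ (i : Fin N) (x : JointAction d),
    ConvexOn ℝ Set.univ (fun y : Action d i => ℓ i (deviate x i y))
  differentiable : ∀ (i : Fin N) (x : JointAction d),
    Differentiable ℝ (fun y : Action d i => ℓ i (deviate x i y))
  lipschitz : ∀ i : Fin N, LipschitzWith L (indivGrad ℓ i)

/-- Variational stability: a Nash equilibrium exists, and `⟨V(x), x - x⋆⟩ ≥ 0` for every joint
action `x` and every Nash equilibrium `x⋆`. -/
structure VariationallyStable (ℓ : Fin N → JointAction d → ℝ) : Prop where
  exists_nash : ∃ x : JointAction d, IsNash ℓ x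
  inner_nonneg : ∀ x xs : JointAction d, IsNash ℓ xs → 0 ≤ inner ℝ (jointGrad ℓ x) (x - xs)

end Game

section Dynamics

variable {N : ℕ} {d : Fin N → ℕ} {Ω : Type*}

/-- The feedback `gⁱ_t = Vⁱ(x_t) + ξⁱ_t` received for the joint action `x_t` at round `t ≥ 1`,
with the convention `gⁱ_0 = 0`. -/
def feedback (ℓ : Fin N → JointAction d → ℝ) (x : ℕ → Ω → JointAction d)
    (ξ : ℕ → (i : Fin N) → Ω → Action d i) (t : ℕ) (i : Fin N) (ω : Ω) : Action d i :=
  if t = 0 then 0 else indivGrad ℓ i (x t ω) + ξ t i ω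

/-- `∑_{s=1}^t ‖gⁱ_s‖²` (zero for `t = 0`). -/
def cumSq (g : ℕ → (i : Fin N) → Ω → Action d i) (t : ℕ) (i : Fin N) (ω : Ω) : ℝ :=
  ∑ s ∈ Finset.Icc 1 t, ‖g s i ω‖ ^ 2

/-- `∑_{s=1}^t ‖Xⁱ_s - Xⁱ_{s+1}‖²` (zero for `t = 0`). -/
def pathSq (X : ℕ → Ω → JointAction d) (t : ℕ) (i : Fin N) (ω : Ω) : ℝ :=
  ∑ s ∈ Finset.Icc 1 t, ‖X s ω i - X (s + 1) ω i‖ ^ 2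

/-- The adaptive extrapolation step size
`γⁱ_t = (1 + ∑_{s=1}^{t-2} ‖gⁱ_s‖²)^{-(1/2 - q)}`. The sum is empty for `t ≤ 2`, which the
truncated subtraction `t - 2` renders. -/
def extrapStep (q : ℝ) (g : ℕ → (i : Fin N) → Ω → Action d i)
    (t : ℕ) (i : Fin N) (ω : Ω) : ℝ :=
  1 / (1 + cumSq g (t - 2) i ω) ^ (1 / 2 - q)

/-- The adaptive update step size
`ηⁱ_t = (1 + ∑_{s=1}^{t-2} (‖gⁱ_s‖² + ‖Xⁱ_s - Xⁱ_{s+1}‖²))^{-1/2}`, with the same convention. -/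
def updateStep (g : ℕ → (i : Fin N) → Ω → Action d i) (X : ℕ → Ω → JointAction d)
    (t : ℕ) (i : Fin N) (ω : Ω) : ℝ :=
  1 / √(1 + cumSq g (t - 2) i ω + pathSq X (t - 2) i ω)

/-- All players run OptDA+ with the adaptive step sizes: `X t` is `X_t`, `x t` is the action
`X_{t+1/2}` played at round `t`, and rounds are numbered from `1`. -/
structure RunsAdaptiveOptDAPlus (ℓ : Fin N → JointAction d → ℝ) (q : ℝ)
    (ξ : ℕ → (i : Fin N) → Ω → Action d i) (X x : ℕ → Ω → JointAction d) : Prop where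
  extrapolate : ∀ t : ℕ, 1 ≤ t → ∀ (i : Fin N) (ω : Ω),
    x t ω i = X t ω i - extrapStep q (feedback ℓ x ξ) t i ω • feedback ℓ x ξ (t - 1) i ω
  update : ∀ t : ℕ, 1 ≤ t → ∀ (i : Fin N) (ω : Ω),
    X (t + 1) ω i = X 1 ω i - updateStep (feedback ℓ x ξ) X (t + 1) i ω •
      ∑ s ∈ Finset.Icc 1 t, feedback ℓ x ξ s i ω

/-- The natural filtration of the played actions: the σ-algebra generated by `x_1, …, x_t`. -/
abbrev playHistory (x : ℕ → Ω → JointAction d) (t : ℕ) : MeasurableSpace Ω :=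
  ⨆ s ∈ Set.Icc 1 t, MeasurableSpace.comap (x s) (borel (JointAction d))

/-- Noise conditions: conditionally on `x_1, …, x_t`, the noise `ξⁱ_t` has zero mean and its
second moment is at most `σA² + σM² ‖Vⁱ(x_t)‖²`. -/
structure NoiseModel [MeasurableSpace Ω] (μ : Measure Ω) (ℓ : Fin N → JointAction d → ℝ)
    (x : ℕ → Ω → JointAction d) (ξ : ℕ → (i : Fin N) → Ω → Action d i) (σA σM : ℝ) : Prop where
  measurable : ∀ t : ℕ, 1 ≤ t → ∀ i : Fin N, Measurable (ξ t i)
  unbiased : ∀ t : ℕ, 1 ≤ t → ∀ i : Fin N, μ[ξ t i | playHistory x t] =ᵐ[μ] 0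
  variance : ∀ t : ℕ, 1 ≤ t → ∀ i : Fin N,
    μ[fun ω => ‖ξ t i ω‖ ^ 2 | playHistory x t] ≤ᵐ[μ]
      fun ω => σA ^ 2 + σM ^ 2 * ‖indivGrad ℓ i (x t ω)‖ ^ 2

/-- Bounded feedback: the individual gradients are bounded by `G` everywhere, and the noise is
almost surely bounded by `B`. -/
structure BoundedFeedback [MeasurableSpace Ω] (μ : Measure Ω) (ℓ : Fin N → JointAction d → ℝ)
    (ξ : ℕ → (i : Fin N) → Ω → Action d i) (G B : ℝ) : Prop where
  grad_le : ∀ (i : Fin N) (x : JointAction d), ‖indivGrad ℓ i x‖ ≤ G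
  noise_le : ∀ t : ℕ, 1 ≤ t → ∀ i : Fin N, ∀ᵐ ω ∂μ, ‖ξ t i ω‖ ≤ B

end Dynamics

end NoisyGame

end

/-!
Write `ρⁱ_t = 1 / ηⁱ_t`, and let `p` be a Nash equilibrium. One step of dual averaging bounds the
growth of `∑ᵢ ρⁱ_t ‖Xⁱ_t - pⁱ‖²` by adaptive terms that sum to `O(∑ᵢ √(1 + λⁱ_T + μⁱ_T))`, minus
twice the regret `⟨g_t, x_t - p⟩`, whose drift is nonnegative by variational stability, and minus
`2 ∑ᵢ γⁱ_t ⟨gⁱ_t, gⁱ_{t-1}⟩`. In expectation this correlation is at least `∑ᵢ γⁱ_t ‖Vⁱ(x_t)‖²` up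
to adaptive terms: consecutive actions are close, and the noise of round `t - 1` moves `x_t` by at
most `2 γⁱ_t` times its size, which costs terms of order
`(γⁱ_t)² ‖gⁱ_{t-1}‖² ≤ ‖gⁱ_{t-1}‖² / √(1 + λⁱ_{t-2})` since `q ≤ 1/4`.

Under multiplicative noise the gradient energy `∑ₜ ∑ᵢ γⁱ_t ‖Vⁱ(x_t)‖²` controls, again in
expectation, the feedback energy `∑ₜ ∑ᵢ γⁱ_t ‖gⁱ_t‖²`. As `γⁱ_t ≥ (1 + λⁱ_T)^(q - 1/2)` for
`t ≤ T`, the latter dominates a power of `1 + λⁱ_T` whose exponent exceeds `1/2`, so the adaptive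
terms can be absorbed. Hence `E[∑ᵢ √(1 + λⁱ_T + μⁱ_T)]` and the expected gradient energy are bounded
uniformly in `T`: almost surely `λⁱ` and `μⁱ` converge, the step sizes have positive limits, and
`∑ₜ ‖V(x_t)‖² < ∞`.

Finally `∑ᵢ ρⁱ_t ‖Xⁱ_t - pⁱ‖²` is an almost-supermartingale with summable errors, so it converges
almost surely for all `p` in a countable dense set of equilibria at once. Every cluster point of
`X_t` is a zero of `V`, hence an equilibrium, and an Opial argument with converging weights
concludes.
-/

noncomputable section

namespace NoisyGame

open Finset

/-! ### Real sequences and inner products -/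

section RealSequences

variable {a : ℕ → ℝ}

theorem sum_Icc_one_le_sum_Icc_one (ha : ∀ t, 0 ≤ a t) {s t : ℕ} (hst : s ≤ t) :
    ∑ k ∈ Icc 1 s, a k ≤ ∑ k ∈ Icc 1 t, a k :=
  sum_le_sum_of_subset_of_nonneg (Icc_subset_Icc_right hst) fun k _ _ => ha k

theorem sum_Icc_one_pred_le (ha : ∀ t, 0 ≤ a t) (h0 : a 0 = 0) (T : ℕ) :
    ∑ t ∈ Icc 1 T, a (t - 1) ≤ ∑ t ∈ Icc 1 T, a t := by
  suffices ∑ t ∈ Icc 1 T, a (t - 1) + a T = ∑ t ∈ Icc 1 T, a t by linarith [ha T]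
  induction T with
  | zero => simpa using h0
  | succ T ih => rw [sum_Icc_succ_top (by lia), sum_Icc_succ_top (by lia), Nat.add_sub_cancel, ih]

theorem sum_Icc_one_le_add_sum_Icc_pred {b : ℕ → ℝ} {C : ℝ} (hC : 0 ≤ C) (h1 : a 1 ≤ C)
    (hsucc : ∀ t, 1 ≤ t → a (t + 1) ≤ b t) (T : ℕ) :
    ∑ t ∈ Icc 1 T, a t ≤ C + ∑ t ∈ Icc 1 (T - 1), b t := by
  match T with
  | 0 => simpa using hC
  | T + 1 =>
    rw [Nat.add_sub_cancel]
    induction T with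
    | zero => simpa using h1
    | succ T ih =>
      rw [sum_Icc_succ_top (by lia), sum_Icc_succ_top (by lia) b, ← add_assoc]
      exact add_le_add ih (hsucc (T + 1) (by lia))

theorem le_add_sum_Icc_one_of_succ_le {b : ℕ → ℝ} (h : ∀ t, 1 ≤ t → a (t + 1) ≤ a t + b t)
    (T : ℕ) : a (T + 1) ≤ a 1 + ∑ t ∈ Icc 1 T, b t := by
  induction T with
  | zero => simp
  | succ T ih =>
    rw [sum_Icc_succ_top (by lia), ← add_assoc]
    exact (h (T + 1) (by lia)).trans (add_le_add_left ih _)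

theorem sum_range_succ_eq_sum_Icc_one (a : ℕ → ℝ) (T : ℕ) :
    ∑ n ∈ range T, a (n + 1) = ∑ t ∈ Icc 1 T, a t := by
  rw [range_eq_Ico, sum_Ico_add']
  rfl

theorem div_sqrt_add_le_two_mul_sub {x y : ℝ} (hx : 0 ≤ x) (hy : 0 < y) :
    x / √(y + x) ≤ 2 * (√(y + x) - √y) := by
  have hsq : √(y + x) ^ 2 = y + x := Real.sq_sqrt (by positivity)
  have hsq' : √y ^ 2 = y := Real.sq_sqrt hy.le
  rw [div_le_iff₀ (by positivity)]
  nlinarith [sq_nonneg (√(y + x) - √y)]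

theorem sum_div_sqrt_one_add_sum_le (ha : ∀ t, 0 ≤ a t) (T : ℕ) :
    ∑ t ∈ Icc 1 T, a t / √(1 + ∑ s ∈ Icc 1 t, a s) ≤ 2 * √(1 + ∑ s ∈ Icc 1 T, a s) := by
  induction T with
  | zero => simp
  | succ T ih =>
    have hpos : 0 < 1 + ∑ s ∈ Icc 1 T, a s := by
      linarith [sum_nonneg fun s (_ : s ∈ Icc 1 T) => ha s]
    have hlast := div_sqrt_add_le_two_mul_sub (ha (T + 1)) hpos
    rw [sum_Icc_succ_top (by lia), sum_Icc_succ_top (by lia : 1 ≤ T + 1) a, ← add_assoc]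
    linarith

theorem sum_Icc_le_sum_Icc_sub_two_add {M : ℝ} (ha : ∀ t, 0 ≤ a t) (haM : ∀ t, a t ≤ M) (t : ℕ) :
    ∑ s ∈ Icc 1 t, a s ≤ ∑ s ∈ Icc 1 (t - 2), a s + 2 * M := by
  have hM : 0 ≤ M := (ha 0).trans (haM 0)
  match t with
  | 0 => simpa using hM
  | 1 => simpa using (haM 1).trans (by linarith)
  | t + 2 =>
    rw [sum_Icc_succ_top (by lia), sum_Icc_succ_top (by lia), Nat.add_sub_cancel]
    linarith [haM (t + 1), haM (t + 1 + 1)]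

theorem sum_div_sqrt_one_add_sum_delayed_le {M : ℝ} (ha : ∀ t, 0 ≤ a t) (haM : ∀ t, a t ≤ M)
    (T : ℕ) :
    ∑ t ∈ Icc 1 T, a t / √(1 + ∑ s ∈ Icc 1 (t - 2), a s) ≤
      2 * √(1 + 2 * M) * √(1 + ∑ s ∈ Icc 1 T, a s) := by
  have hM : 0 ≤ M := (ha 0).trans (haM 0)
  have hS : ∀ t, 0 ≤ ∑ s ∈ Icc 1 t, a s := fun t => sum_nonneg fun s _ => ha s
  have hsqrt : ∀ t, √(1 + ∑ s ∈ Icc 1 t, a s) ≤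
      √(1 + 2 * M) * √(1 + ∑ s ∈ Icc 1 (t - 2), a s) := by
    intro t
    rw [← Real.sqrt_mul (by positivity)]
    apply Real.sqrt_le_sqrt
    nlinarith [sum_Icc_le_sum_Icc_sub_two_add ha haM t, hS (t - 2)]
  have hterm : ∀ t, a t / √(1 + ∑ s ∈ Icc 1 (t - 2), a s) ≤
      √(1 + 2 * M) * (a t / √(1 + ∑ s ∈ Icc 1 t, a s)) := by
    intro t
    have := hS t
    have := hS (t - 2)
    rw [mul_div_assoc', div_le_div_iff₀ (by positivity) (by positivity), mul_right_comm, mul_comm]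
    exact mul_le_mul_of_nonneg_right (hsqrt t) (ha t)
  calc ∑ t ∈ Icc 1 T, a t / √(1 + ∑ s ∈ Icc 1 (t - 2), a s)
      ≤ √(1 + 2 * M) * ∑ t ∈ Icc 1 T, a t / √(1 + ∑ s ∈ Icc 1 t, a s) := by
        rw [mul_sum]
        exact sum_le_sum fun t _ => hterm t
    _ ≤ √(1 + 2 * M) * (2 * √(1 + ∑ s ∈ Icc 1 T, a s)) := by
        gcongr
        exact sum_div_sqrt_one_add_sum_le ha T
    _ = _ := by ring

theorem sum_min_sub_mul_sqrt_delayed_le {A K : ℝ} (ha : ∀ t, 0 ≤ a t) (hA : 0 ≤ A) (hK : 0 ≤ K)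
    (T : ℕ) :
    ∑ t ∈ Icc 1 T, (min A (K * a t) - a t * √(1 + ∑ s ∈ Icc 1 (t - 2), a s) / 2) ≤
      4 * K ^ 3 + 2 * A := by
  set f : ℕ → ℝ := fun t => min A (K * a t) - a t * √(1 + ∑ s ∈ Icc 1 (t - 2), a s) / 2
  have hf : ∀ t, f t ≤ min A (K * a t) := fun t =>
    sub_le_self _ (div_nonneg (mul_nonneg (ha t) (Real.sqrt_nonneg _)) zero_le_two)
  have hfA : ∀ t, f t ≤ A := fun t => (hf t).trans (min_le_left _ _)
  have hfK : ∀ t, f t ≤ K * a t := fun t => (hf t).trans (min_le_right _ _)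
  induction T with
  | zero => simp only [zero_lt_one, Icc_eq_empty_of_lt, sum_empty]; positivity
  | succ T ih =>
    rw [sum_Icc_succ_top (by lia) f]
    by_cases hsmall : ∑ s ∈ Icc 1 (T - 1), a s ≤ 4 * K ^ 2
    · -- Up to round `T - 1` the linear bound applies, and the last two terms are at most `A`.
      have hlin : ∑ t ∈ Icc 1 (T - 1), f t ≤ 4 * K ^ 3 :=
        calc ∑ t ∈ Icc 1 (T - 1), f t ≤ ∑ t ∈ Icc 1 (T - 1), K * a t :=
              sum_le_sum fun t _ => hfK t
          _ = K * ∑ t ∈ Icc 1 (T - 1), a t := (mul_sum ..).symm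
          _ ≤ K * (4 * K ^ 2) := by gcongr
          _ = 4 * K ^ 3 := by ring
      match T with
      | 0 => simpa using (hfA 1).trans (by linarith [pow_nonneg hK 3] : A ≤ 4 * K ^ 3 + 2 * A)
      | T + 1 =>
        rw [sum_Icc_succ_top (by lia) f]
        rw [Nat.add_sub_cancel] at hlin
        linarith [hfA (T + 1), hfA (T + 1 + 1)]
    · -- Past that point the drift dominates the linear term.
      have hroot : 2 * K ≤ √(1 + ∑ s ∈ Icc 1 (T - 1), a s) :=
        Real.le_sqrt_of_sq_le (by nlinarith)
      have hlast : f (T + 1) ≤ 0 := by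
        have := mul_le_mul_of_nonneg_left hroot (ha (T + 1))
        have := min_le_right A (K * a (T + 1))
        simp only [f, show T + 1 - 2 = T - 1 by lia]
        linarith
      linarith

theorem rpow_sub_one_le_sum_delayed {q : ℝ} (ha : ∀ t, 0 ≤ a t) (hq : q ≤ 1 / 2) (T : ℕ) :
    (1 + ∑ s ∈ Icc 1 T, a s) ^ (1 / 2 + q) - 1 ≤
      ∑ t ∈ Icc 1 T, 1 / (1 + ∑ s ∈ Icc 1 (t - 2), a s) ^ (1 / 2 - q) * a t := by
  have hS : ∀ t, 0 ≤ ∑ s ∈ Icc 1 t, a s := fun t => sum_nonneg fun s _ => ha s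
  set r := (1 + ∑ s ∈ Icc 1 T, a s) ^ (1 / 2 - q) with hr
  have hbase : 1 ≤ 1 + ∑ s ∈ Icc 1 T, a s := by linarith [hS T]
  have hr1 : 1 ≤ r := Real.one_le_rpow hbase (by linarith)
  calc (1 + ∑ s ∈ Icc 1 T, a s) ^ (1 / 2 + q) - 1
      = (1 + ∑ s ∈ Icc 1 T, a s) / r - 1 := by
        rw [sub_left_inj, eq_div_iff (by positivity), hr, ← Real.rpow_add (by positivity)]
        norm_num
    _ ≤ (1 + ∑ s ∈ Icc 1 T, a s) / r - 1 / r := by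
        gcongr
        exact (div_le_one (by positivity)).2 hr1
    _ = ∑ t ∈ Icc 1 T, 1 / r * a t := by rw [← mul_sum]; ring
    _ ≤ _ := by
        refine sum_le_sum fun t ht => mul_le_mul_of_nonneg_right ?_ (ha t)
        have hpos : 0 < 1 + ∑ s ∈ Icc 1 (t - 2), a s := by linarith [hS (t - 2)]
        have hle : ∑ s ∈ Icc 1 (t - 2), a s ≤ ∑ s ∈ Icc 1 T, a s :=
          sum_Icc_one_le_sum_Icc_one ha ((t.sub_le 2).trans (mem_Icc.1 ht).2)
        exact one_div_le_one_div_of_le (by positivity)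
          (Real.rpow_le_rpow hpos.le (by linarith) (by linarith))

end RealSequences

section RealInequalities

theorem exists_sqrt_le_mul_rpow_add {q ε : ℝ} (hq : 0 < q) (hε : 0 < ε) :
    ∃ C : ℝ, 0 ≤ C ∧ ∀ y : ℝ, 1 ≤ y → √y ≤ ε * y ^ (1 / 2 + q) + C := by
  refine ⟨√((1 / ε) ^ (1 / q)), Real.sqrt_nonneg _, fun y hy => ?_⟩
  have hy0 : 0 < y := by linarith
  rcases le_total (1 / ε) (y ^ q) with hlarge | hsmall
  · have hroot : √y ≤ ε * y ^ (1 / 2 + q) :=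
      calc √y = ε * (√y * (1 / ε)) := by field_simp
        _ ≤ ε * (√y * y ^ q) := by gcongr
        _ = ε * y ^ (1 / 2 + q) := by rw [Real.sqrt_eq_rpow, ← Real.rpow_add hy0]
    linarith [Real.sqrt_nonneg ((1 / ε) ^ (1 / q))]
  · have hy' : y ≤ (1 / ε) ^ (1 / q) :=
      calc y = (y ^ q) ^ (1 / q) := by
            rw [← Real.rpow_mul hy0.le, mul_one_div_cancel hq.ne', Real.rpow_one]
        _ ≤ (1 / ε) ^ (1 / q) := by gcongr
    have : 0 ≤ ε * y ^ (1 / 2 + q) := by positivity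
    linarith [Real.sqrt_le_sqrt hy']

theorem sqrt_le_mul_add_one_div {ε x : ℝ} (hε : 0 < ε) (hx : 0 ≤ x) : √x ≤ ε * x + 1 / ε := by
  have hsq : √x ^ 2 = x := Real.sq_sqrt hx
  have : 0 ≤ (ε * √x - 1) ^ 2 / ε + √x := by positivity
  have : (ε * √x - 1) ^ 2 / ε = ε * √x ^ 2 - 2 * √x + 1 / ε := by
    field_simp
    ring
  rw [hsq] at this
  linarith

theorem min_sum_le_sum_min {ι : Type*} (s : Finset ι) {A : ℝ} (hA : 0 ≤ A) {b : ι → ℝ}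
    (hb : ∀ j, 0 ≤ b j) : min A (∑ j ∈ s, b j) ≤ ∑ j ∈ s, min A (b j) := by
  refine le_sum_of_subadditive_on_pred (min A) (0 ≤ ·) (min_eq_right hA).le
    (fun x y hx hy => ?_) (fun x y hx hy => add_nonneg hx hy) b fun j _ => hb j
  grind

end RealInequalities

section InnerProduct

variable {E : Type*} [NormedAddCommGroup E] [InnerProductSpace ℝ E]

theorem dualAveraging_descent {x₁ p S g : E} {η η' : ℝ} (hη' : 0 < η') (hle : η' ≤ η) :
    ‖x₁ - η' • (S + g) - p‖ ^ 2 / η' ≤ ‖x₁ - η • S - p‖ ^ 2 / η +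
      (1 / η' - 1 / η) * ‖x₁ - p‖ ^ 2 - 2 * inner ℝ g (x₁ - η' • (S + g) - p) -
      ‖(x₁ - η • S) - (x₁ - η' • (S + g))‖ ^ 2 / η := by
  have hη : 0 < η := hη'.trans_le hle
  obtain ⟨z, rfl⟩ : ∃ z, x₁ = z + p := ⟨x₁ - p, by simp⟩
  obtain ⟨S', rfl⟩ : ∃ S', g = S' - S := ⟨S + g, by simp⟩
  have hcancel : ∀ v : E, z + p - v - p = z - v := fun v => by abel
  rw [add_sub_cancel, hcancel, hcancel, add_sub_cancel_right, sub_sub_sub_cancel_left]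
  -- The two sides differ by this quantity.
  have hgap : 0 ≤ η' * ‖S'‖ ^ 2 * (1 - η' / η) := by
    have : 0 ≤ 1 - η' / η := sub_nonneg.2 ((div_le_one hη).2 hle)
    positivity
  rw [← sub_nonneg]
  convert hgap using 1
  simp only [@norm_sub_sq_real, inner_sub_left, inner_sub_right, norm_smul, inner_smul_left,
    inner_smul_right, mul_pow, Real.norm_eq_abs, sq_abs, RCLike.conj_to_real,
    real_inner_self_eq_norm_sq]
  rw [real_inner_comm S' z, real_inner_comm S z, real_inner_comm S' S]
  field_simp
  ring

theorem two_mul_inner_le_mul_norm_sq_add {a b : E} {c : ℝ} (hc : 0 < c) :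
    2 * inner ℝ a b ≤ c * ‖a‖ ^ 2 + ‖b‖ ^ 2 / c := by
  have hsq : 0 ≤ (c * ‖a‖ - ‖b‖) ^ 2 / c := by positivity
  have hexp : (c * ‖a‖ - ‖b‖) ^ 2 / c = c * ‖a‖ ^ 2 + ‖b‖ ^ 2 / c - 2 * (‖a‖ * ‖b‖) := by
    field_simp
    ring
  linarith [real_inner_le_norm a b]

theorem neg_two_mul_inner_add_le {u v w e : E} {c K D : ℝ} (hc0 : 0 ≤ c) (hc1 : c ≤ 1)
    (hK : 0 ≤ K) (hw : ‖u - w‖ ≤ K * D) :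
    -2 * c * inner ℝ u (v + e) ≤ -(c * ‖u‖ ^ 2) + ‖u - v‖ ^ 2 + K * (D ^ 2 + c ^ 2 * ‖e‖ ^ 2) +
      inner ℝ e ((-2 * c) • w) := by
  have hv : -2 * c * inner ℝ u v ≤ -(c * ‖u‖ ^ 2) + ‖u - v‖ ^ 2 := by
    have hexp : c * ‖u - v‖ ^ 2 = c * ‖u‖ ^ 2 - 2 * c * inner ℝ u v + c * ‖v‖ ^ 2 := by
      rw [norm_sub_sq_real]
      ring
    linarith [mul_le_of_le_one_left (sq_nonneg ‖u - v‖) hc1,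
      mul_nonneg hc0 (sq_nonneg ‖v‖)]
  have he : -2 * c * inner ℝ (u - w) e ≤ K * (D ^ 2 + c ^ 2 * ‖e‖ ^ 2) :=
    calc -2 * c * inner ℝ (u - w) e = 2 * c * inner ℝ (-(u - w)) e := by
          rw [inner_neg_left]
          ring
      _ ≤ 2 * c * (K * D * ‖e‖) := by
          gcongr
          refine (real_inner_le_norm _ _).trans ?_
          rw [norm_neg]
          gcongr
      _ = K * (2 * D * (c * ‖e‖)) := by ring
      _ ≤ K * (D ^ 2 + (c * ‖e‖) ^ 2) := by
          gcongr
          exact two_mul_le_add_sq D (c * ‖e‖)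
      _ = K * (D ^ 2 + c ^ 2 * ‖e‖ ^ 2) := by rw [mul_pow]
  rw [inner_sub_left] at he
  rw [inner_add_right, inner_smul_right, real_inner_comm w e]
  linarith

theorem mul_norm_sq_le_mul_norm_add_sq_add_inner {v e : E} {c : ℝ} (hc : 0 ≤ c) :
    c * ‖e‖ ^ 2 ≤ c * ‖v + e‖ ^ 2 + inner ℝ e ((-2 * c) • v) := by
  rw [norm_add_sq_real, inner_smul_right, real_inner_comm]
  linarith [mul_nonneg hc (sq_nonneg ‖v‖)]

theorem apply_le_of_convexOn_of_gradient_eq_zero [CompleteSpace E] {f : E → ℝ}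
    (hf : ConvexOn ℝ Set.univ f) {a : E} (hd : DifferentiableAt ℝ f a) (h0 : gradient f a = 0)
    (y : E) : f a ≤ f y := by
  have hgrad : HasFDerivAt f (0 : E →L[ℝ] ℝ) (AffineMap.lineMap (k := ℝ) a y (0 : ℝ)) := by
    simpa [h0] using hd.hasGradientAt.hasFDerivAt
  have hline : ConvexOn ℝ Set.univ (f ∘ AffineMap.lineMap (k := ℝ) a y) := by
    simpa using hf.comp_affineMap (AffineMap.lineMap (k := ℝ) a y)
  have hderiv : HasDerivAt (f ∘ AffineMap.lineMap (k := ℝ) a y) 0 0 := by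
    simpa using hgrad.comp_hasDerivAt (0 : ℝ) (AffineMap.hasDerivAt_lineMap (a := a) (b := y))
  have := hline.le_slope_of_hasDerivAt (Set.mem_univ 0) (Set.mem_univ 1) zero_lt_one hderiv
  simpa [slope_def_field] using this

end InnerProduct

theorem norm_add₃_sq_le {E : Type*} [SeminormedAddCommGroup E] (a b c : E) :
    ‖a + b + c‖ ^ 2 ≤ 3 * (‖a‖ ^ 2 + ‖b‖ ^ 2 + ‖c‖ ^ 2) := by
  have := pow_le_pow_left₀ (norm_nonneg _) (norm_add₃_le (a := a) (b := b) (c := c)) 2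
  nlinarith [sq_nonneg (‖a‖ - ‖b‖), sq_nonneg (‖b‖ - ‖c‖), sq_nonneg (‖a‖ - ‖c‖)]

/-! ### Bounded measurable maps and almost sure convergence -/

section BddMeasurable

variable {Ω : Type*} {m m0 : MeasurableSpace Ω} {μ : Measure Ω}

/-- `f` is strongly measurable with respect to `m` and bounded almost everywhere: a class closed
under all the operations below, in which integrability is never an issue. -/
structure BddMeasurable {E : Type*} [NormedAddCommGroup E] (m : MeasurableSpace Ω)
    {m0 : MeasurableSpace Ω} (μ : Measure Ω) (f : Ω → E) : Prop where
  stronglyMeasurable : StronglyMeasurable[m] f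
  exists_bound : ∃ C : ℝ, ∀ᵐ ω ∂μ, ‖f ω‖ ≤ C

namespace BddMeasurable

variable {E F : Type*} [NormedAddCommGroup E] [NormedAddCommGroup F]

theorem mono {m' : MeasurableSpace Ω} {f : Ω → E} (hf : BddMeasurable m μ f) (h : m ≤ m') :
    BddMeasurable m' μ f :=
  ⟨hf.stronglyMeasurable.mono h, hf.exists_bound⟩

theorem integrable [IsFiniteMeasure μ] {f : Ω → E} (hf : BddMeasurable m μ f) (h : m ≤ m0) :
    Integrable f μ := by
  obtain ⟨C, hC⟩ := hf.exists_bound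
  exact Integrable.of_bound (hf.stronglyMeasurable.mono h).aestronglyMeasurable C hC

theorem const (c : E) : BddMeasurable m μ (fun _ : Ω => c) :=
  ⟨stronglyMeasurable_const, ‖c‖, ae_of_all _ fun _ => le_rfl⟩

theorem add {f g : Ω → E} (hf : BddMeasurable m μ f) (hg : BddMeasurable m μ g) :
    BddMeasurable m μ (fun ω => f ω + g ω) := by
  obtain ⟨C, hC⟩ := hf.exists_bound
  obtain ⟨D, hD⟩ := hg.exists_bound
  refine ⟨hf.stronglyMeasurable.add hg.stronglyMeasurable, C + D, ?_⟩
  filter_upwards [hC, hD] with ω hfω hgω using (norm_add_le _ _).trans (add_le_add hfω hgω)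

theorem neg {f : Ω → E} (hf : BddMeasurable m μ f) : BddMeasurable m μ (fun ω => -f ω) := by
  obtain ⟨C, hC⟩ := hf.exists_bound
  exact ⟨hf.stronglyMeasurable.neg, C, by simpa only [norm_neg] using hC⟩

theorem sub {f g : Ω → E} (hf : BddMeasurable m μ f) (hg : BddMeasurable m μ g) :
    BddMeasurable m μ (fun ω => f ω - g ω) := by
  simpa only [sub_eq_add_neg] using hf.add hg.neg

theorem sum {ι : Type*} (s : Finset ι) {f : ι → Ω → E}
    (hf : ∀ i ∈ s, BddMeasurable m μ (f i)) : BddMeasurable m μ (fun ω => ∑ i ∈ s, f i ω) := by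
  simpa only [← Finset.sum_apply] using!
    sum_induction f (BddMeasurable m μ) (fun _ _ => add) (const 0) hf

theorem smul [NormedSpace ℝ E] {c : Ω → ℝ} {f : Ω → E} (hc : BddMeasurable m μ c)
    (hf : BddMeasurable m μ f) : BddMeasurable m μ (fun ω => c ω • f ω) := by
  obtain ⟨C, hC⟩ := hc.exists_bound
  obtain ⟨D, hD⟩ := hf.exists_bound
  refine ⟨hc.stronglyMeasurable.smul hf.stronglyMeasurable, C * D, ?_⟩
  filter_upwards [hC, hD] with ω hcω hfω
  rw [norm_smul]
  exact mul_le_mul hcω hfω (norm_nonneg _) ((norm_nonneg _).trans hcω)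

theorem mul {c f : Ω → ℝ} (hc : BddMeasurable m μ c) (hf : BddMeasurable m μ f) :
    BddMeasurable m μ (fun ω => c ω * f ω) :=
  hc.smul hf

theorem inner [InnerProductSpace ℝ E] {f g : Ω → E} (hf : BddMeasurable m μ f)
    (hg : BddMeasurable m μ g) : BddMeasurable m μ (fun ω => inner ℝ (f ω) (g ω)) := by
  obtain ⟨C, hC⟩ := hf.exists_bound
  obtain ⟨D, hD⟩ := hg.exists_bound
  refine ⟨hf.stronglyMeasurable.inner hg.stronglyMeasurable, C * D, ?_⟩
  filter_upwards [hC, hD] with ω hfω hgω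
  exact (norm_inner_le_norm _ _).trans
    (mul_le_mul hfω hgω (norm_nonneg _) ((norm_nonneg _).trans hfω))

theorem comp_continuous [ProperSpace E] {φ : E → F} (hφ : Continuous φ) {f : Ω → E}
    (hf : BddMeasurable m μ f) : BddMeasurable m μ (fun ω => φ (f ω)) := by
  obtain ⟨C, hC⟩ := hf.exists_bound
  obtain ⟨D, hD⟩ := (isCompact_closedBall (0 : E) C).exists_bound_of_continuousOn hφ.continuousOn
  refine ⟨hφ.comp_stronglyMeasurable hf.stronglyMeasurable, D, ?_⟩
  filter_upwards [hC] with ω hfω using hD _ (by simpa using hfω)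

theorem norm_sq {f : Ω → E} (hf : BddMeasurable m μ f) :
    BddMeasurable m μ (fun ω => ‖f ω‖ ^ 2) := by
  obtain ⟨C, hC⟩ := hf.exists_bound
  have hnorm : BddMeasurable m μ (fun ω => ‖f ω‖) :=
    ⟨hf.stronglyMeasurable.norm, C, by simpa only [norm_norm] using hC⟩
  simpa only [sq] using hnorm.mul hnorm

theorem pow {f : Ω → ℝ} (hf : BddMeasurable m μ f) (n : ℕ) :
    BddMeasurable m μ (fun ω => f ω ^ n) :=
  hf.comp_continuous (continuous_pow n)

theorem sqrt {f : Ω → ℝ} (hf : BddMeasurable m μ f) : BddMeasurable m μ (fun ω => √(f ω)) :=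
  hf.comp_continuous Real.continuous_sqrt

end BddMeasurable

end BddMeasurable

section ConditionalExpectation

variable {Ω : Type*} {m m0 : MeasurableSpace Ω} {μ : Measure Ω}

variable {E : Type*} [NormedAddCommGroup E] [InnerProductSpace ℝ E] [CompleteSpace E]

theorem condExp_inner_eq_zero {ζ Y : Ω → E} (hζ : Integrable ζ μ) (hζ0 : μ[ζ | m] =ᵐ[μ] 0)
    (hY : StronglyMeasurable[m] Y) (hζY : Integrable (fun ω => inner ℝ (ζ ω) (Y ω)) μ) :
    μ[fun ω => inner ℝ (ζ ω) (Y ω) | m] =ᵐ[μ] 0 := by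
  have hpull : μ[fun ω => inner ℝ (ζ ω) (Y ω) | m] =ᵐ[μ] fun ω => inner ℝ (μ[ζ | m] ω) (Y ω) :=
    condExp_bilin_of_stronglyMeasurable_right (innerSL ℝ (E := E)) hY hζY hζ
  filter_upwards [hpull, hζ0] with ω hpullω hζω
  simp [hpullω, hζω]

variable [IsFiniteMeasure μ]

theorem integral_mul_le_integral_mul_of_condExp_le (hm : m ≤ m0) {f h w : Ω → ℝ}
    (hf : Integrable f μ) (hw : StronglyMeasurable[m] w) (hw0 : ∀ ω, 0 ≤ w ω)
    (hwf : Integrable (fun ω => w ω * f ω) μ) (hwh : Integrable (fun ω => w ω * h ω) μ)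
    (hle : μ[f | m] ≤ᵐ[μ] h) : ∫ ω, w ω * f ω ∂μ ≤ ∫ ω, w ω * h ω ∂μ := by
  have hpull : μ[fun ω => w ω * f ω | m] =ᵐ[μ] fun ω => w ω * μ[f | m] ω :=
    condExp_mul_of_stronglyMeasurable_left hw hwf hf
  rw [← integral_condExp hm]
  refine integral_mono_ae integrable_condExp hwh ?_
  filter_upwards [hpull, hle] with ω hpullω hleω
  rw [hpullω]
  exact mul_le_mul_of_nonneg_left hleω (hw0 ω)

theorem integral_inner_eq_zero (hm : m ≤ m0) {ζ Y : Ω → E} (hζ : Integrable ζ μ)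
    (hζ0 : μ[ζ | m] =ᵐ[μ] 0) (hY : StronglyMeasurable[m] Y)
    (hζY : Integrable (fun ω => inner ℝ (ζ ω) (Y ω)) μ) :
    ∫ ω, inner ℝ (ζ ω) (Y ω) ∂μ = 0 := by
  rw [← integral_condExp hm, integral_congr_ae (condExp_inner_eq_zero hζ hζ0 hY hζY)]
  simp

theorem integral_mul_norm_add_sq_le (hm : m ≤ m0) {c : Ω → ℝ} {V ζ : Ω → E} {σ : ℝ}
    (hc : BddMeasurable m μ c) (hc0 : ∀ ω, 0 ≤ c ω) (hV : BddMeasurable m μ V)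
    (hζ : BddMeasurable m0 μ ζ) (hζ0 : μ[ζ | m] =ᵐ[μ] 0)
    (hvar : μ[fun ω => ‖ζ ω‖ ^ 2 | m] ≤ᵐ[μ] fun ω => σ ^ 2 * ‖V ω‖ ^ 2) :
    ∫ ω, c ω * ‖V ω + ζ ω‖ ^ 2 ∂μ ≤ (1 + σ ^ 2) * ∫ ω, c ω * ‖V ω‖ ^ 2 ∂μ := by
  have hcV := (hc.mul hV.norm_sq).integrable hm
  have hcζ := ((hc.mono hm).mul hζ.norm_sq).integrable le_rfl
  have hdir : BddMeasurable m μ fun ω => (2 * c ω) • V ω :=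
    ((BddMeasurable.const 2).mul hc).smul hV
  have hinner := (hζ.inner (hdir.mono hm)).integrable le_rfl
  have hmean : ∫ ω, inner ℝ (ζ ω) ((2 * c ω) • V ω) ∂μ = 0 :=
    integral_inner_eq_zero hm (hζ.integrable le_rfl) hζ0 hdir.stronglyMeasurable hinner
  have hnoise : ∫ ω, c ω * ‖ζ ω‖ ^ 2 ∂μ ≤ σ ^ 2 * ∫ ω, c ω * ‖V ω‖ ^ 2 ∂μ := by
    rw [← integral_const_mul]
    simp only [mul_left_comm]
    exact integral_mul_le_integral_mul_of_condExp_le hm (hζ.norm_sq.integrable le_rfl)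
      hc.stronglyMeasurable hc0 hcζ
      ((hc.mul ((BddMeasurable.const _).mul hV.norm_sq)).integrable hm) hvar
  calc ∫ ω, c ω * ‖V ω + ζ ω‖ ^ 2 ∂μ
      = ∫ ω, (c ω * ‖V ω‖ ^ 2 + inner ℝ (ζ ω) ((2 * c ω) • V ω) + c ω * ‖ζ ω‖ ^ 2) ∂μ := by
        refine integral_congr_ae (ae_of_all _ fun ω => ?_)
        simp only [norm_add_sq_real, inner_smul_right, real_inner_comm (ζ ω)]
        ring
    _ = ∫ ω, c ω * ‖V ω‖ ^ 2 ∂μ + ∫ ω, c ω * ‖ζ ω‖ ^ 2 ∂μ := by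
        rw [integral_add (by exact hcV.add hinner) hcζ, integral_add hcV hinner, hmean, add_zero]
    _ ≤ _ := by linarith

end ConditionalExpectation

section AlmostSureConvergence

variable {Ω : Type*} {m0 : MeasurableSpace Ω} {μ : Measure Ω}

theorem ae_bddAbove_of_integral_le {f : ℕ → Ω → ℝ} {C : ℝ} (hf : ∀ n, Integrable (f n) μ)
    (hf0 : ∀ n ω, 0 ≤ f n ω) (hmono : ∀ ω, Monotone fun n => f n ω)
    (hC : ∀ n, ∫ ω, f n ω ∂μ ≤ C) : ∀ᵐ ω ∂μ, BddAbove (Set.range fun n => f n ω) := by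
  have hlint : ∫⁻ ω, ⨆ n, ENNReal.ofReal (f n ω) ∂μ ≤ ENNReal.ofReal C := by
    rw [lintegral_iSup' (fun n => (hf n).aemeasurable.ennreal_ofReal)
      (ae_of_all _ fun ω a b hab => ENNReal.ofReal_le_ofReal (hmono ω hab))]
    refine iSup_le fun n => ?_
    rw [← ofReal_integral_eq_lintegral_ofReal (hf n) (ae_of_all _ (hf0 n))]
    exact ENNReal.ofReal_le_ofReal (hC n)
  have hfin := ae_lt_top' (AEMeasurable.iSup fun n => (hf n).aemeasurable.ennreal_ofReal)
    (hlint.trans_lt ENNReal.ofReal_lt_top).ne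
  filter_upwards [hfin] with ω hω
  refine ⟨(⨆ n, ENNReal.ofReal (f n ω)).toReal, Set.forall_mem_range.2 fun n => ?_⟩
  rw [← ENNReal.ofReal_le_iff_le_toReal hω.ne]
  exact le_iSup (fun n => ENNReal.ofReal (f n ω)) n

variable [IsFiniteMeasure μ] {ℱ : Filtration ℕ m0}

theorem ae_tendsto_of_supermartingale_of_neg_le {M B : ℕ → Ω → ℝ} {C : ℝ}
    (hM : Supermartingale M ℱ μ) (hB : ∀ n, Integrable (B n) μ) (hB0 : ∀ n ω, 0 ≤ B n ω)
    (hMB : ∀ n ω, -B n ω ≤ M n ω) (hC : ∀ n, ∫ ω, B n ω ∂μ ≤ C) :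
    ∀ᵐ ω ∂μ, ∃ l, Tendsto (fun n => M n ω) atTop (𝓝 l) := by
  have hnorm : ∀ n, ∫ ω, ‖(-M) n ω‖ ∂μ ≤ ∫ ω, M 0 ω ∂μ + 2 * C := fun n =>
    calc ∫ ω, ‖(-M) n ω‖ ∂μ
        ≤ ∫ ω, (M n ω + 2 * B n ω) ∂μ := by
          refine integral_mono (hM.integrable n).neg.norm
            ((hM.integrable n).add ((hB n).const_mul 2)) fun ω => ?_
          simp only [Pi.neg_apply, norm_neg, Real.norm_eq_abs, abs_le]
          constructor <;> linarith [hMB n ω, hB0 n ω]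
      _ = ∫ ω, M n ω ∂μ + 2 * ∫ ω, B n ω ∂μ := by
          rw [integral_add (hM.integrable n) ((hB n).const_mul 2), integral_const_mul]
      _ ≤ ∫ ω, M 0 ω ∂μ + 2 * C := by
          have := hM.setIntegral_le (Nat.zero_le n) MeasurableSet.univ
          simp only [setIntegral_univ] at this
          linarith [hC n]
  have hconv := hM.neg.exists_ae_tendsto_of_bdd (R := (∫ ω, M 0 ω ∂μ + 2 * C).toNNReal)
    fun n => by
      rw [eLpNorm_one_eq_lintegral_enorm, Pi.neg_apply,
        ← ofReal_integral_norm_eq_lintegral_enorm (hM.integrable n).neg]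
      exact ENNReal.ofReal_le_ofReal (hnorm n)
  filter_upwards [hconv] with ω ⟨l, hl⟩
  exact ⟨-l, by simpa using hl.neg⟩

theorem supermartingale_sub_sum_of_le {u b v : ℕ → Ω → ℝ}
    (hu : ∀ n, StronglyMeasurable[ℱ n] (u n)) (huI : ∀ n, Integrable (u n) μ)
    (hb : ∀ n, StronglyMeasurable[ℱ (n + 1)] (b n)) (hbI : ∀ n, Integrable (b n) μ)
    (hvI : ∀ n, Integrable (v n) μ) (hv0 : ∀ n, 0 ≤ᵐ[μ] μ[v n | ℱ n])
    (hstep : ∀ n, ∀ᵐ ω ∂μ, u (n + 1) ω ≤ u n ω + b n ω - v n ω) :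
    Supermartingale (fun n ω => u n ω - ∑ k ∈ range n, b k ω) ℱ μ := by
  set M : ℕ → Ω → ℝ := fun n ω => u n ω - ∑ k ∈ range n, b k ω with hM
  have hMmeas : ∀ n, StronglyMeasurable[ℱ n] (M n) := fun n =>
    (hu n).sub (stronglyMeasurable_fun_sum _ fun k hk => (hb k).mono (ℱ.mono (mem_range.1 hk)))
  have hMint : ∀ n, Integrable (M n) μ := fun n =>
    (huI n).sub (integrable_finsetSum _ fun k _ => hbI k)
  refine supermartingale_nat hMmeas hMint fun n => ?_
  have hdecr : M (n + 1) ≤ᵐ[μ] M n - v n := by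
    filter_upwards [hstep n] with ω hω
    simp only [hM, Pi.sub_apply, sum_range_succ]
    linarith
  have hcond := condExp_mono (m := ℱ n) (hMint (n + 1)) ((hMint n).sub (hvI n)) hdecr
  have hsub := condExp_sub (hMint n) (hvI n) (ℱ n)
  rw [condExp_of_stronglyMeasurable (ℱ.le n) (hMmeas n) (hMint n)] at hsub
  filter_upwards [hcond, hsub, hv0 n] with ω hcondω hsubω hvω
  rw [hsubω, Pi.sub_apply] at hcondω
  simp only [Pi.zero_apply] at hvω
  linarith

theorem ae_tendsto_of_almost_supermartingale {u b v : ℕ → Ω → ℝ} {C : ℝ}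
    (hu : ∀ n, StronglyMeasurable[ℱ n] (u n)) (huI : ∀ n, Integrable (u n) μ)
    (hb : ∀ n, StronglyMeasurable[ℱ (n + 1)] (b n)) (hbI : ∀ n, Integrable (b n) μ)
    (hvI : ∀ n, Integrable (v n) μ) (hv0 : ∀ n, 0 ≤ᵐ[μ] μ[v n | ℱ n])
    (hstep : ∀ n, ∀ᵐ ω ∂μ, u (n + 1) ω ≤ u n ω + b n ω - v n ω)
    (hu0 : ∀ n ω, 0 ≤ u n ω) (hb0 : ∀ n ω, 0 ≤ b n ω)
    (hC : ∀ n, ∫ ω, ∑ k ∈ range n, b k ω ∂μ ≤ C) :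
    ∀ᵐ ω ∂μ, ∃ l, Tendsto (fun n => u n ω) atTop (𝓝 l) := by
  have hBI : ∀ n, Integrable (fun ω => ∑ k ∈ range n, b k ω) μ := fun n =>
    integrable_finsetSum _ fun k _ => hbI k
  have hB0 : ∀ n ω, 0 ≤ ∑ k ∈ range n, b k ω := fun n ω => sum_nonneg fun k _ => hb0 k ω
  have hBmono : ∀ ω, Monotone fun n => ∑ k ∈ range n, b k ω := fun ω =>
    monotone_nat_of_le_succ fun n => by
      simpa only [sum_range_succ] using le_add_of_nonneg_right (hb0 n ω)
  have hsuper := supermartingale_sub_sum_of_le hu huI hb hbI hvI hv0 hstep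
  have hconv := ae_tendsto_of_supermartingale_of_neg_le hsuper hBI hB0
    (fun n ω => by linarith [hu0 n ω]) hC
  filter_upwards [hconv, ae_bddAbove_of_integral_le hBI hB0 hBmono hC] with ω ⟨l, hl⟩ hbdd
  exact ⟨_, by simpa using hl.add (tendsto_atTop_ciSup (hBmono ω) hbdd)⟩

end AlmostSureConvergence

/-! ### Opial's lemma with converging weights -/

section Opial

variable {ι : Type*} [Fintype ι] {E : ι → Type*} [∀ i, NormedAddCommGroup (E i)] {α : Type*}
  {F : Filter α} {Z : α → PiLp 2 E} {w : α → ι → ℝ} {w' : ι → ℝ} {z p : PiLp 2 E} {l : ℝ}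

theorem sum_mul_norm_sub_sq_eq_of_mapClusterPt (hw : ∀ i, Tendsto (fun t => w t i) F (𝓝 (w' i)))
    (hl : Tendsto (fun t => ∑ i, w t i * ‖Z t i - p i‖ ^ 2) F (𝓝 l)) (hz : MapClusterPt z F Z) :
    ∑ i, w' i * ‖z i - p i‖ ^ 2 = l := by
  obtain ⟨U, hUF, hU⟩ := mapClusterPt_iff_ultrafilter.1 hz
  have hcoord : ∀ i, Tendsto (fun t => Z t i) U (𝓝 (z i)) := fun i =>
    ((PiLp.continuous_apply 2 E i).tendsto z).comp hU
  exact tendsto_nhds_unique (tendsto_finsetSum _ fun i _ =>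
    ((hw i).mono_left hUF).mul (((hcoord i).sub_const (p i)).norm.pow 2)) (hl.mono_left hUF)

theorem exists_eventually_mem_closedBall (hw : ∀ i, Tendsto (fun t => w t i) F (𝓝 (w' i)))
    (hw' : ∀ i, 0 < w' i) (hl : Tendsto (fun t => ∑ i, w t i * ‖Z t i - p i‖ ^ 2) F (𝓝 l)) :
    ∃ r, ∀ᶠ t in F, Z t ∈ Metric.closedBall p r := by
  obtain ⟨c, hcw, hc⟩ : ∃ c, (∀ i, c < w' i) ∧ 0 < c :=
    ((eventually_all.2 fun i => mem_nhdsWithin_of_mem_nhds (Iio_mem_nhds (hw' i))).and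
      (self_mem_nhdsWithin (a := (0 : ℝ)) (s := Set.Ioi 0))).exists
  refine ⟨√((l + 1) / c), ?_⟩
  filter_upwards [eventually_all.2 fun i => (hw i).eventually (lt_mem_nhds (hcw i)),
    hl.eventually (gt_mem_nhds (lt_add_one l))] with t hct hlt
  rw [Metric.mem_closedBall, dist_eq_norm]
  refine Real.le_sqrt_of_sq_le ((le_div_iff₀' hc).2 (le_trans ?_ hlt.le))
  rw [PiLp.norm_sq_eq_of_L2, mul_sum]
  exact sum_le_sum fun i _ => mul_le_mul_of_nonneg_right (hct i).le (by positivity)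

theorem exists_tendsto_of_tendsto_sum_mul_norm_sub_sq [ProperSpace (PiLp 2 E)] [F.NeBot]
    {S D : Set (PiLp 2 E)} (hw : ∀ i, Tendsto (fun t => w t i) F (𝓝 (w' i)))
    (hw' : ∀ i, 0 < w' i) (hS : S.Nonempty) (hSD : S ⊆ closure D)
    (hD : ∀ p ∈ D, ∃ l, Tendsto (fun t => ∑ i, w t i * ‖Z t i - p i‖ ^ 2) F (𝓝 l))
    (hcluster : ∀ z, MapClusterPt z F Z → z ∈ S) : ∃ z ∈ S, Tendsto Z F (𝓝 z) := by
  obtain ⟨p, hp⟩ : D.Nonempty := closure_nonempty_iff.1 (hS.mono hSD)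
  obtain ⟨l, hl⟩ := hD p hp
  obtain ⟨r, hr⟩ := exists_eventually_mem_closedBall hw hw' hl
  have hcompact := isCompact_closedBall p r
  obtain ⟨z, -, hz⟩ := hcompact.exists_mapClusterPt (le_principal_iff.2 hr)
  refine ⟨z, hcluster z hz, hcompact.tendsto_nhds_of_unique_mapClusterPt hr fun z' _ hz' => ?_⟩
  have heq : closure D ⊆ {p | ∑ i, w' i * ‖z' i - p i‖ ^ 2 = ∑ i, w' i * ‖z i - p i‖ ^ 2} := by
    refine closure_minimal (fun p hp => ?_) (isClosed_eq (by fun_prop) (by fun_prop))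
    obtain ⟨l, hl⟩ := hD p hp
    exact (sum_mul_norm_sub_sq_eq_of_mapClusterPt hw hl hz').trans
      (sum_mul_norm_sub_sq_eq_of_mapClusterPt hw hl hz).symm
  have hzero : ∑ i, w' i * ‖z' i - z i‖ ^ 2 = 0 := by
    simpa using heq (hSD (hcluster z hz))
  refine PiLp.ext fun i => sub_eq_zero.1 (norm_eq_zero.1 (pow_eq_zero_iff two_ne_zero |>.1 ?_))
  have hi := (sum_eq_zero_iff_of_nonneg fun i _ =>
    mul_nonneg (hw' i).le (sq_nonneg ‖z' i - z i‖)).1 hzero i (mem_univ i)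
  exact (mul_eq_zero.1 hi).resolve_left (hw' i).ne'

end Opial

/-! ### Adaptive step sizes -/

section StepSizes

variable {N : ℕ} {d : Fin N → ℕ} {Ω : Type*} {g : ℕ → (i : Fin N) → Ω → Action d i}
  {X : ℕ → Ω → JointAction d} {q : ℝ} {t : ℕ} {i : Fin N} {ω : Ω}

/-- The undelayed normalization `(1 + ∑_{s=1}^t (‖gⁱ_s‖² + ‖Xⁱ_s - Xⁱ_{s+1}‖²))^{1/2}`, which
controls all accumulated errors. -/
def stepWeight (g : ℕ → (i : Fin N) → Ω → Action d i) (X : ℕ → Ω → JointAction d)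
    (t : ℕ) (i : Fin N) (ω : Ω) : ℝ :=
  √(1 + cumSq g t i ω + pathSq X t i ω)

/-- The inverse `1 / ηⁱ_t` of the update step size. -/
def invStep (g : ℕ → (i : Fin N) → Ω → Action d i) (X : ℕ → Ω → JointAction d) (t : ℕ) :
    (i : Fin N) → Ω → ℝ :=
  stepWeight g X (t - 2)

/-- The squared feedback `‖gⁱ_t‖² / (1 + ∑_{s=1}^{t-2} ‖gⁱ_s‖²)^{1/2}` in the normalization of
adaptive gradient methods. -/
def normalizedSq (g : ℕ → (i : Fin N) → Ω → Action d i) (t : ℕ) (i : Fin N) (ω : Ω) : ℝ :=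
  ‖g t i ω‖ ^ 2 / √(1 + cumSq g (t - 2) i ω)

theorem cumSq_nonneg : 0 ≤ cumSq g t i ω := sum_nonneg fun _ _ => by positivity

theorem pathSq_nonneg : 0 ≤ pathSq X t i ω := sum_nonneg fun _ _ => by positivity

theorem normalizedSq_nonneg : 0 ≤ normalizedSq g t i ω := by
  unfold normalizedSq
  positivity

theorem one_add_cumSq_pos : 0 < 1 + cumSq g t i ω := add_pos_of_pos_of_nonneg one_pos cumSq_nonneg

theorem cumSq_mono : Monotone fun t => cumSq g t i ω := fun _ _ hst =>
  sum_Icc_one_le_sum_Icc_one (a := fun s => ‖g s i ω‖ ^ 2) (fun _ => by positivity) hst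

theorem pathSq_mono : Monotone fun t => pathSq X t i ω := fun _ _ hst =>
  sum_Icc_one_le_sum_Icc_one (a := fun s => ‖X s ω i - X (s + 1) ω i‖ ^ 2)
    (fun _ => by positivity) hst

theorem stepWeight_mono : Monotone fun t => stepWeight g X t i ω := fun _ _ hst =>
  Real.sqrt_le_sqrt (add_le_add (add_le_add le_rfl (cumSq_mono hst)) (pathSq_mono hst))

theorem stepWeight_nonneg : 0 ≤ stepWeight g X t i ω := Real.sqrt_nonneg _

theorem stepWeight_sq : stepWeight g X t i ω ^ 2 = 1 + cumSq g t i ω + pathSq X t i ω :=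
  Real.sq_sqrt (add_nonneg one_add_cumSq_pos.le pathSq_nonneg)

theorem sqrt_one_add_cumSq_le_stepWeight : √(1 + cumSq g t i ω) ≤ stepWeight g X t i ω :=
  Real.sqrt_le_sqrt (le_add_of_nonneg_right pathSq_nonneg)

theorem sqrt_one_add_pathSq_le_stepWeight : √(1 + pathSq X t i ω) ≤ stepWeight g X t i ω :=
  Real.sqrt_le_sqrt (add_le_add_left (le_add_of_nonneg_right cumSq_nonneg) _)

theorem one_le_stepWeight : 1 ≤ stepWeight g X t i ω :=
  (Real.one_le_sqrt.2 (le_add_of_nonneg_right cumSq_nonneg)).trans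
    sqrt_one_add_cumSq_le_stepWeight

theorem updateStep_eq_one_div_invStep : updateStep g X t i ω = 1 / invStep g X t i ω := rfl

theorem invStep_mono : Monotone fun t => invStep g X t i ω := fun _ _ hst =>
  stepWeight_mono (Nat.sub_le_sub_right hst 2)

theorem invStep_pos : 0 < invStep g X t i ω := one_pos.trans_le one_le_stepWeight

theorem invStep_succ_le_stepWeight : invStep g X (t + 1) i ω ≤ stepWeight g X t i ω :=
  stepWeight_mono (by lia)

theorem updateStep_pos : 0 < updateStep g X t i ω := one_div_pos.2 invStep_pos

theorem updateStep_le_one : updateStep g X t i ω ≤ 1 := (div_le_one invStep_pos).2 one_le_stepWeight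

theorem updateStep_antitone : Antitone fun t => updateStep g X t i ω := fun _ _ hst =>
  one_div_le_one_div_of_le invStep_pos (invStep_mono hst)

theorem extrapStep_pos : 0 < extrapStep q g t i ω :=
  one_div_pos.2 (Real.rpow_pos_of_pos one_add_cumSq_pos _)

theorem extrapStep_antitone (hq : q ≤ 1 / 2) : Antitone fun t => extrapStep q g t i ω :=
  fun _ _ hst => one_div_le_one_div_of_le (Real.rpow_pos_of_pos one_add_cumSq_pos _)
    (Real.rpow_le_rpow one_add_cumSq_pos.le
      (add_le_add le_rfl (cumSq_mono (Nat.sub_le_sub_right hst 2))) (by linarith))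

theorem extrapStep_le_one (hq : q ≤ 1 / 2) : extrapStep q g t i ω ≤ 1 :=
  div_le_one_of_le₀ (Real.one_le_rpow (le_add_of_nonneg_right cumSq_nonneg) (by linarith))
    (Real.rpow_nonneg one_add_cumSq_pos.le _)

theorem updateStep_le_extrapStep (hq : 0 ≤ q) : updateStep g X t i ω ≤ extrapStep q g t i ω := by
  refine one_div_le_one_div_of_le (Real.rpow_pos_of_pos one_add_cumSq_pos _) ?_
  calc (1 + cumSq g (t - 2) i ω) ^ (1 / 2 - q) ≤ (1 + cumSq g (t - 2) i ω) ^ (1 / 2 : ℝ) :=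
        Real.rpow_le_rpow_of_exponent_le (le_add_of_nonneg_right cumSq_nonneg) (by linarith)
    _ = √(1 + cumSq g (t - 2) i ω) := (Real.sqrt_eq_rpow _).symm
    _ ≤ invStep g X t i ω := sqrt_one_add_cumSq_le_stepWeight

theorem extrapStep_sq_le (hq : q ≤ 1 / 4) :
    extrapStep q g t i ω ^ 2 ≤ 1 / √(1 + cumSq g (t - 2) i ω) := by
  have hpos : 0 < 1 + cumSq g (t - 2) i ω := one_add_cumSq_pos
  rw [extrapStep, div_pow, one_pow, ← Real.rpow_mul_natCast hpos.le, Real.sqrt_eq_rpow]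
  refine one_div_le_one_div_of_le (Real.rpow_pos_of_pos hpos _)
    (Real.rpow_le_rpow_of_exponent_le (le_add_of_nonneg_right cumSq_nonneg) ?_)
  push_cast
  linarith

theorem extrapStep_sq_mul_le_normalizedSq (hq : q ≤ 1 / 4) {s : ℕ} (hst : t ≤ s) :
    extrapStep q g s i ω ^ 2 * ‖g t i ω‖ ^ 2 ≤ normalizedSq g t i ω := by
  have hanti : extrapStep q g s i ω ≤ extrapStep q g t i ω :=
    extrapStep_antitone (hq.trans (by norm_num)) hst
  have hsq : extrapStep q g s i ω ^ 2 ≤ 1 / √(1 + cumSq g (t - 2) i ω) :=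
    (pow_le_pow_left₀ extrapStep_pos.le hanti 2).trans (extrapStep_sq_le hq)
  calc extrapStep q g s i ω ^ 2 * ‖g t i ω‖ ^ 2
      ≤ 1 / √(1 + cumSq g (t - 2) i ω) * ‖g t i ω‖ ^ 2 := by gcongr
    _ = normalizedSq g t i ω := by rw [normalizedSq, one_div_mul_eq_div]

theorem norm_sq_div_invStep_le_normalizedSq :
    ‖g t i ω‖ ^ 2 / invStep g X t i ω ≤ normalizedSq g t i ω :=
  div_le_div_of_nonneg_left (by positivity) (Real.sqrt_pos.2 one_add_cumSq_pos)
    sqrt_one_add_cumSq_le_stepWeight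

theorem sum_normalizedSq_le {M : ℝ} (hg : ∀ t, ‖g t i ω‖ ≤ M) (T : ℕ) :
    ∑ t ∈ Icc 1 T, normalizedSq g t i ω ≤ 2 * √(1 + 2 * M ^ 2) * stepWeight g X T i ω :=
  (sum_div_sqrt_one_add_sum_delayed_le (a := fun t => ‖g t i ω‖ ^ 2) (fun _ => by positivity)
    (fun t => pow_le_pow_left₀ (norm_nonneg _) (hg t) 2) T).trans
    (mul_le_mul_of_nonneg_left sqrt_one_add_cumSq_le_stepWeight (by positivity))

theorem exists_stepWeight_le (hq0 : 0 < q) (hq : q ≤ 1 / 2) {ε : ℝ} (hε : 0 < ε) :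
    ∃ C : ℝ, ∀ (g : ℕ → (i : Fin N) → Ω → Action d i) (X : ℕ → Ω → JointAction d)
      (T : ℕ) (i : Fin N) (ω : Ω), stepWeight g X T i ω ≤
        ε * ∑ t ∈ Icc 1 T, extrapStep q g t i ω * ‖g t i ω‖ ^ 2 + ε * pathSq X T i ω + C := by
  obtain ⟨C, -, hC⟩ := exists_sqrt_le_mul_rpow_add hq0 hε
  refine ⟨ε + C + 1 / ε, fun g X T i ω => ?_⟩
  have hsplit : stepWeight g X T i ω ≤ √(1 + cumSq g T i ω) + √(pathSq X T i ω) :=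
    (Real.sqrt_le_left (by positivity)).2 <| by
      nlinarith [Real.sq_sqrt (one_add_cumSq_pos (g := g) (t := T) (i := i) (ω := ω)).le,
        Real.sq_sqrt (pathSq_nonneg (X := X) (t := T) (i := i) (ω := ω)),
        Real.sqrt_nonneg (1 + cumSq g T i ω), Real.sqrt_nonneg (pathSq X T i ω)]
  have hcum : √(1 + cumSq g T i ω) ≤ ε * (1 + cumSq g T i ω) ^ (1 / 2 + q) + C :=
    hC _ (le_add_of_nonneg_right cumSq_nonneg)
  have henergy : (1 + cumSq g T i ω) ^ (1 / 2 + q) - 1 ≤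
      ∑ t ∈ Icc 1 T, extrapStep q g t i ω * ‖g t i ω‖ ^ 2 :=
    rpow_sub_one_le_sum_delayed (a := fun t => ‖g t i ω‖ ^ 2) (fun _ => by positivity) hq T
  have hpath : √(pathSq X T i ω) ≤ ε * pathSq X T i ω + 1 / ε :=
    sqrt_le_mul_add_one_div hε pathSq_nonneg
  linarith [mul_le_mul_of_nonneg_left henergy hε.le]

section Limits

variable {l m : ℝ}

theorem exists_tendsto_extrapStep (hl : Tendsto (fun t => cumSq g t i ω) atTop (𝓝 l)) :
    ∃ γ : ℝ, 0 < γ ∧ Tendsto (fun t => extrapStep q g t i ω) atTop (𝓝 γ) := by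
  have hl0 : 0 < 1 + l := by linarith [ge_of_tendsto' hl fun _ => cumSq_nonneg]
  have hpos : 0 < (1 + l) ^ (1 / 2 - q) := Real.rpow_pos_of_pos hl0 _
  exact ⟨1 / (1 + l) ^ (1 / 2 - q), one_div_pos.2 hpos, tendsto_const_nhds.div
    (((hl.comp (tendsto_sub_atTop_nat 2)).const_add 1).rpow_const (Or.inl hl0.ne')) hpos.ne'⟩

theorem exists_tendsto_invStep (hl : Tendsto (fun t => cumSq g t i ω) atTop (𝓝 l))
    (hm : Tendsto (fun t => pathSq X t i ω) atTop (𝓝 m)) :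
    ∃ ρ : ℝ, 0 < ρ ∧ Tendsto (fun t => invStep g X t i ω) atTop (𝓝 ρ) := by
  have hl0 : 0 ≤ l := ge_of_tendsto' hl fun _ => cumSq_nonneg
  have hm0 : 0 ≤ m := ge_of_tendsto' hm fun _ => pathSq_nonneg
  exact ⟨√(1 + l + m), Real.sqrt_pos.2 (by linarith),
    ((hl.const_add 1).add hm).sqrt.comp (tendsto_sub_atTop_nat 2)⟩

theorem exists_tendsto_updateStep (hl : Tendsto (fun t => cumSq g t i ω) atTop (𝓝 l))
    (hm : Tendsto (fun t => pathSq X t i ω) atTop (𝓝 m)) :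
    ∃ η : ℝ, 0 < η ∧ Tendsto (fun t => updateStep g X t i ω) atTop (𝓝 η) := by
  obtain ⟨ρ, hρ, hlim⟩ := exists_tendsto_invStep hl hm
  exact ⟨1 / ρ, one_div_pos.2 hρ, tendsto_const_nhds.div hlim hρ.ne'⟩

theorem tendsto_norm_of_tendsto_cumSq (hl : Tendsto (fun t => cumSq g t i ω) atTop (𝓝 l)) :
    Tendsto (fun t => ‖g t i ω‖) atTop (𝓝 0) := by
  have hsq : Tendsto (fun t => ‖g (t + 1) i ω‖ ^ 2) atTop (𝓝 0) := by
    have hdiff := ((tendsto_add_atTop_iff_nat 1).2 hl).sub hl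
    rw [sub_self] at hdiff
    exact hdiff.congr fun t => by
      rw [cumSq, cumSq, sum_Icc_succ_top (by lia), add_sub_cancel_left]
  simpa only [Real.sqrt_sq (norm_nonneg _), Real.sqrt_zero, tendsto_add_atTop_iff_nat
    (f := fun t => ‖g t i ω‖)] using hsq.sqrt

theorem exists_tendsto_cumSq_and_pathSq (hw : BddAbove (Set.range fun t => stepWeight g X t i ω)) :
    (∃ l, Tendsto (fun t => cumSq g t i ω) atTop (𝓝 l)) ∧
      ∃ m, Tendsto (fun t => pathSq X t i ω) atTop (𝓝 m) := by
  obtain ⟨K, hK⟩ := hw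
  have hsq : ∀ t, 1 + cumSq g t i ω + pathSq X t i ω ≤ K ^ 2 := fun t =>
    stepWeight_sq.symm.trans_le (pow_le_pow_left₀ stepWeight_nonneg (hK ⟨t, rfl⟩) 2)
  refine ⟨⟨_, tendsto_atTop_ciSup cumSq_mono ⟨K ^ 2, ?_⟩⟩,
    ⟨_, tendsto_atTop_ciSup pathSq_mono ⟨K ^ 2, ?_⟩⟩⟩
  · rintro _ ⟨t, rfl⟩
    linarith [hsq t, pathSq_nonneg (X := X) (t := t) (i := i) (ω := ω)]
  · rintro _ ⟨t, rfl⟩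
    linarith [hsq t, cumSq_nonneg (g := g) (t := t) (i := i) (ω := ω)]

end Limits

end StepSizes

section Run

variable {N : ℕ} {d : Fin N → ℕ} {Ω : Type*} {m m0 : MeasurableSpace Ω} {μ : Measure Ω}
  {ℓ : Fin N → JointAction d → ℝ} {L : ℝ≥0} {σM G B q R : ℝ}
  {ξ : ℕ → (i : Fin N) → Ω → Action d i} {X x : ℕ → Ω → JointAction d}
  {p : JointAction d} {t : ℕ} {i : Fin N} {ω : Ω}

local notation "fb" => feedback ℓ x ξ
local notation "stepγ" => extrapStep q (feedback ℓ x ξ)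
local notation "stepη" => updateStep (feedback ℓ x ξ) X
local notation "stepρ" => invStep (feedback ℓ x ξ) X
local notation "nsq" => normalizedSq (feedback ℓ x ξ)
local notation "wt" => stepWeight (feedback ℓ x ξ) X

theorem feedback_zero : fb 0 i ω = 0 := rfl

theorem feedback_of_pos (ht : 1 ≤ t) : fb t i ω = indivGrad ℓ i (x t ω) + ξ t i ω :=
  if_neg (Nat.one_le_iff_ne_zero.1 ht)

/-! ### The descent inequality -/

/-- The weighted squared distance `‖Xⁱ_t - pⁱ‖² / ηⁱ_t` of player `i` to `p`, the Lyapunov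
function of dual averaging. -/
def weightedDist (g : ℕ → (i : Fin N) → Ω → Action d i) (X : ℕ → Ω → JointAction d)
    (p : JointAction d) (t : ℕ) (i : Fin N) (ω : Ω) : ℝ :=
  invStep g X t i ω * ‖X t ω i - p i‖ ^ 2

theorem weightedDist_nonneg {g : ℕ → (i : Fin N) → Ω → Action d i} :
    0 ≤ weightedDist g X p t i ω :=
  mul_nonneg invStep_pos.le (by positivity)

theorem RunsAdaptiveOptDAPlus.iterate_eq (hrun : RunsAdaptiveOptDAPlus ℓ q ξ X x) (ht : 1 ≤ t) :
    X t ω i = X 1 ω i - stepη t i ω • ∑ s ∈ Icc 1 (t - 1), fb s i ω := by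
  obtain rfl | ht := ht.eq_or_lt
  · simp
  · obtain ⟨s, rfl⟩ := Nat.exists_eq_add_of_le' (Nat.one_le_of_lt ht)
    exact hrun.update s (by lia) i ω

theorem RunsAdaptiveOptDAPlus.weightedDist_succ_le_inner_succ
    (hrun : RunsAdaptiveOptDAPlus ℓ q ξ X x) (ht : 1 ≤ t) (p : JointAction d) :
    weightedDist fb X p (t + 1) i ω ≤ weightedDist fb X p t i ω +
      (stepρ (t + 1) i ω - stepρ t i ω) * ‖X 1 ω i - p i‖ ^ 2 -
      2 * inner ℝ (fb t i ω) (X (t + 1) ω i - p i) -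
      stepρ t i ω * ‖X t ω i - X (t + 1) ω i‖ ^ 2 := by
  have hX := hrun.iterate_eq ht (i := i) (ω := ω)
  have hX' := hrun.iterate_eq (t := t + 1) (by lia) (i := i) (ω := ω)
  have hsum : ∑ s ∈ Icc 1 (t + 1 - 1), fb s i ω = ∑ s ∈ Icc 1 (t - 1), fb s i ω + fb t i ω := by
    obtain ⟨s, rfl⟩ := Nat.exists_eq_add_of_le' ht
    exact sum_Icc_succ_top (by lia) _
  have hdescent := dualAveraging_descent (x₁ := X 1 ω i) (p := p i)
    (S := ∑ s ∈ Icc 1 (t - 1), fb s i ω) (g := fb t i ω) (η := stepη t i ω)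
    (η' := stepη (t + 1) i ω) updateStep_pos (updateStep_antitone (Nat.le_succ t))
  rw [← hsum, ← hX, ← hX'] at hdescent
  simp only [updateStep_eq_one_div_invStep, div_div_eq_mul_div, div_one] at hdescent
  simp only [weightedDist]
  linarith

theorem RunsAdaptiveOptDAPlus.weightedDist_succ_le (hrun : RunsAdaptiveOptDAPlus ℓ q ξ X x)
    (ht : 1 ≤ t) (p : JointAction d) {c : ℝ} (hc : 0 < c) :
    weightedDist fb X p (t + 1) i ω ≤ weightedDist fb X p t i ω +
      (stepρ (t + 1) i ω - stepρ t i ω) * ‖X 1 ω i - p i‖ ^ 2 + c * nsq t i ω -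
      (1 - 1 / c) * (stepρ t i ω * ‖X t ω i - X (t + 1) ω i‖ ^ 2) -
      2 * inner ℝ (fb t i ω) (x t ω i - p i) -
      2 * stepγ t i ω * inner ℝ (fb t i ω) (fb (t - 1) i ω) := by
  have hρ : 0 < stepρ t i ω := invStep_pos
  have hyoung : 2 * inner ℝ (fb t i ω) (X t ω i - X (t + 1) ω i) ≤
      c * nsq t i ω + 1 / c * (stepρ t i ω * ‖X t ω i - X (t + 1) ω i‖ ^ 2) :=
    calc 2 * inner ℝ (fb t i ω) (X t ω i - X (t + 1) ω i)
        ≤ c / stepρ t i ω * ‖fb t i ω‖ ^ 2 +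
            ‖X t ω i - X (t + 1) ω i‖ ^ 2 / (c / stepρ t i ω) :=
          two_mul_inner_le_mul_norm_sq_add (by positivity)
      _ = c * (‖fb t i ω‖ ^ 2 / stepρ t i ω) +
            1 / c * (stepρ t i ω * ‖X t ω i - X (t + 1) ω i‖ ^ 2) := by field_simp
      _ ≤ _ := by gcongr; exact norm_sq_div_invStep_le_normalizedSq
  have hsplit : inner ℝ (fb t i ω) (X (t + 1) ω i - p i) =
      inner ℝ (fb t i ω) (x t ω i - p i) +
        stepγ t i ω * inner ℝ (fb t i ω) (fb (t - 1) i ω) -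
        inner ℝ (fb t i ω) (X t ω i - X (t + 1) ω i) := by
    rw [← inner_smul_right, ← inner_add_right, ← inner_sub_right, hrun.extrapolate t ht]
    congr 1
    abel
  have hdescent := hrun.weightedDist_succ_le_inner_succ ht p (i := i) (ω := ω)
  rw [hsplit] at hdescent
  linarith

theorem VariationallyStable.sum_inner_nonneg (hst : VariationallyStable ℓ) (hp : IsNash ℓ p)
    (y : JointAction d) : 0 ≤ ∑ i, inner ℝ (indivGrad ℓ i y) (y i - p i) :=
  (PiLp.inner_apply (jointGrad ℓ y) (y - p)).subst (hst.inner_nonneg y p hp)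

/-- The vector paired with the noise `ξⁱ_t` in the descent inequality of round `t`. -/
def regretDirection (g : ℕ → (i : Fin N) → Ω → Action d i) (q : ℝ) (x : ℕ → Ω → JointAction d)
    (p : JointAction d) (t : ℕ) (i : Fin N) (ω : Ω) : Action d i :=
  (-2 : ℝ) • (x t ω i - p i) + (-2 * extrapStep q g t i ω) • g (t - 1) i ω

theorem RunsAdaptiveOptDAPlus.sum_weightedDist_succ_le (hrun : RunsAdaptiveOptDAPlus ℓ q ξ X x)
    (hst : VariationallyStable ℓ) (hp : IsNash ℓ p) (ht : 1 ≤ t) :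
    ∑ i, weightedDist fb X p (t + 1) i ω ≤ ∑ i, (weightedDist fb X p t i ω +
      (stepρ (t + 1) i ω - stepρ t i ω) * ‖X 1 ω i - p i‖ ^ 2 + 4 * nsq t i ω -
      3 / 4 * (stepρ t i ω * ‖X t ω i - X (t + 1) ω i‖ ^ 2) -
      2 * stepγ t i ω * inner ℝ (indivGrad ℓ i (x t ω)) (fb (t - 1) i ω) +
      inner ℝ (ξ t i ω) (regretDirection fb q x p t i ω)) := by
  refine le_trans ?_ (sub_le_self _ (mul_nonneg zero_le_two (hst.sum_inner_nonneg hp (x t ω))))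
  rw [mul_sum, ← sum_sub_distrib]
  refine sum_le_sum fun i _ => (hrun.weightedDist_succ_le ht p four_pos).trans_eq ?_
  rw [regretDirection, feedback_of_pos ht, inner_add_left, inner_add_left, inner_add_right,
    inner_smul_right, inner_smul_right]
  ring

/-! ### Correlation of consecutive feedbacks -/

/-- The joint action of round `t + 1` with the noise of round `t` removed. It is determined by
the actions of the first `t` rounds. -/
def denoised (ℓ : Fin N → JointAction d → ℝ) (q : ℝ) (ξ : ℕ → (i : Fin N) → Ω → Action d i)
    (X x : ℕ → Ω → JointAction d) (t : ℕ) (ω : Ω) : JointAction d :=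
  WithLp.toLp 2 fun i =>
    X 1 ω i - updateStep (feedback ℓ x ξ) X (t + 1) i ω •
      ∑ s ∈ Icc 1 (t - 1), feedback ℓ x ξ s i ω -
    (updateStep (feedback ℓ x ξ) X (t + 1) i ω + extrapStep q (feedback ℓ x ξ) (t + 1) i ω) •
      indivGrad ℓ i (x t ω)

theorem RunsAdaptiveOptDAPlus.play_succ_eq (hrun : RunsAdaptiveOptDAPlus ℓ q ξ X x)
    (ht : 1 ≤ t) :
    x (t + 1) ω i = denoised ℓ q ξ X x t ω i -
      (stepη (t + 1) i ω + stepγ (t + 1) i ω) • ξ t i ω := by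
  rw [hrun.extrapolate (t + 1) (by lia), hrun.update t ht, denoised, Nat.add_sub_cancel]
  obtain ⟨s, rfl⟩ := Nat.exists_eq_add_of_le' ht
  rw [sum_Icc_succ_top (by lia), feedback_of_pos ht, Nat.add_sub_cancel]
  module

theorem RunsAdaptiveOptDAPlus.norm_play_succ_sub_denoised_sq_le
    (hrun : RunsAdaptiveOptDAPlus ℓ q ξ X x) (hq : 0 ≤ q) (ht : 1 ≤ t) :
    ‖x (t + 1) ω - denoised ℓ q ξ X x t ω‖ ^ 2 ≤
      4 * ∑ j, stepγ (t + 1) j ω ^ 2 * ‖ξ t j ω‖ ^ 2 := by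
  rw [PiLp.norm_sq_eq_of_L2, mul_sum]
  refine sum_le_sum fun j _ => ?_
  have hη : 0 < stepη (t + 1) j ω := updateStep_pos
  have hηγ : stepη (t + 1) j ω ≤ stepγ (t + 1) j ω := updateStep_le_extrapStep hq
  have hstep : (stepη (t + 1) j ω + stepγ (t + 1) j ω) ^ 2 ≤ 4 * stepγ (t + 1) j ω ^ 2 := by
    nlinarith
  rw [PiLp.sub_apply, hrun.play_succ_eq ht, sub_sub_cancel_left, norm_neg, norm_smul, mul_pow,
    Real.norm_eq_abs, sq_abs, ← mul_assoc]
  gcongr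

theorem RunsAdaptiveOptDAPlus.norm_play_succ_sub_play_sq_le
    (hrun : RunsAdaptiveOptDAPlus ℓ q ξ X x) (hq : q ≤ 1 / 4) (ht : 1 ≤ t) :
    ‖x (t + 1) ω - x t ω‖ ^ 2 ≤
      ∑ j, (3 * ‖X t ω j - X (t + 1) ω j‖ ^ 2 + 3 * (nsq t j ω + nsq (t - 1) j ω)) := by
  rw [PiLp.norm_sq_eq_of_L2]
  refine sum_le_sum fun j _ => ?_
  have hsplit : x (t + 1) ω j - x t ω j = -(X t ω j - X (t + 1) ω j) +
      -(stepγ (t + 1) j ω • fb t j ω) + stepγ t j ω • fb (t - 1) j ω := by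
    rw [hrun.extrapolate (t + 1) (by lia), hrun.extrapolate t ht, Nat.add_sub_cancel]
    abel
  have hnew : stepγ (t + 1) j ω ^ 2 * ‖fb t j ω‖ ^ 2 ≤ nsq t j ω :=
    extrapStep_sq_mul_le_normalizedSq hq (Nat.le_succ t)
  have hold : stepγ t j ω ^ 2 * ‖fb (t - 1) j ω‖ ^ 2 ≤ nsq (t - 1) j ω :=
    extrapStep_sq_mul_le_normalizedSq hq (Nat.sub_le t 1)
  have hnorm := norm_add₃_sq_le (-(X t ω j - X (t + 1) ω j)) (-(stepγ (t + 1) j ω • fb t j ω))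
    (stepγ t j ω • fb (t - 1) j ω)
  simp only [norm_neg, norm_smul, mul_pow, Real.norm_eq_abs, sq_abs] at hnorm
  rw [PiLp.sub_apply, hsplit]
  linarith

/-- The error made in round `t + 1` by approximating the new gradients with those of round `t`.
The truncation at `4 G²` lets its sum be absorbed although the step sizes are not small. -/
def crossError (ℓ : Fin N → JointAction d → ℝ) (L : ℝ≥0) (G : ℝ)
    (ξ : ℕ → (i : Fin N) → Ω → Action d i) (X x : ℕ → Ω → JointAction d) (t : ℕ) (ω : Ω) : ℝ :=
  ∑ i, (N * min (4 * G ^ 2) (3 * L ^ 2 * ‖X t ω i - X (t + 1) ω i‖ ^ 2) +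
    (3 * L ^ 2 * N + L * (4 * N + 1)) *
      (normalizedSq (feedback ℓ x ξ) t i ω + normalizedSq (feedback ℓ x ξ) (t - 1) i ω))

/-- The vector paired with the noise `ξⁱ_t` in the correlation of the feedbacks of rounds `t`
and `t + 1`. -/
def crossDirection (ℓ : Fin N → JointAction d → ℝ) (L : ℝ≥0) (q : ℝ)
    (ξ : ℕ → (i : Fin N) → Ω → Action d i) (X x : ℕ → Ω → JointAction d) (t : ℕ) (i : Fin N)
    (ω : Ω) : Action d i :=
  (-2 * extrapStep q (feedback ℓ x ξ) (t + 1) i ω) • indivGrad ℓ i (denoised ℓ q ξ X x t ω) +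
    (-2 * (L * (4 * N + 1)) * extrapStep q (feedback ℓ x ξ) (t + 1) i ω ^ 2) •
      indivGrad ℓ i (x t ω)

theorem RunsAdaptiveOptDAPlus.norm_indivGrad_succ_sub_sq_le
    (hrun : RunsAdaptiveOptDAPlus ℓ q ξ X x) (hsm : ConvexSmooth ℓ L)
    (hG : ∀ i y, ‖indivGrad ℓ i y‖ ≤ G) (hq : q ≤ 1 / 4) (ht : 1 ≤ t) :
    ‖indivGrad ℓ i (x (t + 1) ω) - indivGrad ℓ i (x t ω)‖ ^ 2 ≤
      ∑ j, (min (4 * G ^ 2) (3 * L ^ 2 * ‖X t ω j - X (t + 1) ω j‖ ^ 2) +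
        3 * L ^ 2 * (nsq t j ω + nsq (t - 1) j ω)) := by
  set D := ‖indivGrad ℓ i (x (t + 1) ω) - indivGrad ℓ i (x t ω)‖
  have hbdd : D ^ 2 ≤ 4 * G ^ 2 := by
    have hD2 : D ≤ 2 * G := by
      linarith [norm_sub_le (indivGrad ℓ i (x (t + 1) ω)) (indivGrad ℓ i (x t ω)),
        hG i (x (t + 1) ω), hG i (x t ω)]
    exact (pow_le_pow_left₀ (norm_nonneg _) hD2 2).trans_eq (by ring)
  have hlip : D ^ 2 ≤ ∑ j, 3 * L ^ 2 * ‖X t ω j - X (t + 1) ω j‖ ^ 2 +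
      ∑ j, 3 * L ^ 2 * (nsq t j ω + nsq (t - 1) j ω) :=
    calc D ^ 2 ≤ (L * ‖x (t + 1) ω - x t ω‖) ^ 2 := by
          gcongr
          exact (hsm.lipschitz i).norm_sub_le _ _
      _ ≤ (L : ℝ) ^ 2 * ∑ j, (3 * ‖X t ω j - X (t + 1) ω j‖ ^ 2 +
            3 * (nsq t j ω + nsq (t - 1) j ω)) := by
          rw [mul_pow]
          gcongr
          exact hrun.norm_play_succ_sub_play_sq_le hq ht
      _ = _ := by
          rw [mul_sum, ← sum_add_distrib]
          exact sum_congr rfl fun j _ => by ring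
  have herr : 0 ≤ ∑ j, 3 * (L : ℝ) ^ 2 * (nsq t j ω + nsq (t - 1) j ω) :=
    sum_nonneg fun j _ => mul_nonneg (by positivity)
      (add_nonneg normalizedSq_nonneg normalizedSq_nonneg)
  have hmin := min_sum_le_sum_min univ (A := 4 * G ^ 2) (by positivity)
    (b := fun j => 3 * (L : ℝ) ^ 2 * ‖X t ω j - X (t + 1) ω j‖ ^ 2) fun j => by positivity
  rw [sum_add_distrib]
  refine le_trans ?_ (add_le_add_left hmin _)
  rw [← min_add_add_right]
  exact le_min (by linarith) hlip

theorem sum_extrapStep_sq_mul_norm_noise_sq_le (hq : q ≤ 1 / 4) (ht : 1 ≤ t) :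
    ∑ i, stepγ (t + 1) i ω ^ 2 * ‖ξ t i ω‖ ^ 2 ≤ ∑ i, (nsq t i ω + nsq (t - 1) i ω +
      inner ℝ (ξ t i ω) ((-2 * stepγ (t + 1) i ω ^ 2) • indivGrad ℓ i (x t ω))) := by
  refine sum_le_sum fun i _ => (mul_norm_sq_le_mul_norm_add_sq_add_inner
    (v := indivGrad ℓ i (x t ω)) (sq_nonneg _)).trans (add_le_add_left ?_ _)
  rw [← feedback_of_pos ht]
  exact le_add_of_le_of_nonneg (extrapStep_sq_mul_le_normalizedSq hq (Nat.le_succ t))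
    normalizedSq_nonneg

/- Split `gⁱ_t = Vⁱ(x_t) + ξⁱ_t`. The new gradient is close to `Vⁱ(x_t)`, which produces the
negative square. It is correlated with `ξⁱ_t`, but replacing it with the gradient at the denoised
action centers the product with `ξⁱ_t` at the price of second order terms. -/
theorem RunsAdaptiveOptDAPlus.sum_extrapStep_mul_le_crossError
    (hrun : RunsAdaptiveOptDAPlus ℓ q ξ X x) (hsm : ConvexSmooth ℓ L)
    (hG : ∀ i y, ‖indivGrad ℓ i y‖ ≤ G) (hq0 : 0 ≤ q) (hq : q ≤ 1 / 4) (ht : 1 ≤ t) :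
    ∑ i, (stepγ (t + 1) i ω * ‖indivGrad ℓ i (x (t + 1) ω)‖ ^ 2 -
        2 * stepγ (t + 1) i ω * inner ℝ (indivGrad ℓ i (x (t + 1) ω)) (fb t i ω)) ≤
      crossError ℓ L G ξ X x t ω +
        ∑ i, inner ℝ (ξ t i ω) (crossDirection ℓ L q ξ X x t i ω) := by
  set Q := ∑ j, (min (4 * G ^ 2) (3 * L ^ 2 * ‖X t ω j - X (t + 1) ω j‖ ^ 2) +
    3 * L ^ 2 * (nsq t j ω + nsq (t - 1) j ω)) with hQ
  set P := ∑ j, stepγ (t + 1) j ω ^ 2 * ‖ξ t j ω‖ ^ 2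
  have hplayer : ∀ i, stepγ (t + 1) i ω * ‖indivGrad ℓ i (x (t + 1) ω)‖ ^ 2 -
      2 * stepγ (t + 1) i ω * inner ℝ (indivGrad ℓ i (x (t + 1) ω)) (fb t i ω) ≤
      Q + L * (4 * P + stepγ (t + 1) i ω ^ 2 * ‖ξ t i ω‖ ^ 2) +
        inner ℝ (ξ t i ω) ((-2 * stepγ (t + 1) i ω) • indivGrad ℓ i (denoised ℓ q ξ X x t ω)) := by
    intro i
    have hcorr := neg_two_mul_inner_add_le (v := indivGrad ℓ i (x t ω)) (e := ξ t i ω)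
      (c := stepγ (t + 1) i ω) extrapStep_pos.le (extrapStep_le_one (hq.trans (by norm_num)))
      L.coe_nonneg ((hsm.lipschitz i).norm_sub_le (x (t + 1) ω) (denoised ℓ q ξ X x t ω))
    rw [← feedback_of_pos ht] at hcorr
    have hvar := hrun.norm_indivGrad_succ_sub_sq_le hsm hG hq ht (i := i) (ω := ω)
    have hdist := mul_le_mul_of_nonneg_left
      (hrun.norm_play_succ_sub_denoised_sq_le hq0 ht (ω := ω)) L.coe_nonneg
    linarith
  have hP : L * (4 * N + 1) * P ≤ L * (4 * N + 1) * ∑ i, (nsq t i ω + nsq (t - 1) i ω +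
      inner ℝ (ξ t i ω) ((-2 * stepγ (t + 1) i ω ^ 2) • indivGrad ℓ i (x t ω))) :=
    mul_le_mul_of_nonneg_left (sum_extrapStep_sq_mul_norm_noise_sq_le hq ht) (by positivity)
  refine (sum_le_sum fun i _ => hplayer i).trans ?_
  simp only [crossError, crossDirection, inner_add_right, inner_smul_right, sum_add_distrib,
    ← mul_sum, sum_const, card_univ, Fintype.card_fin, nsmul_eq_mul, mul_assoc] at hQ hP ⊢
  rw [hQ]
  linarith

/-! ### Measurability of the iterates -/

theorem BddMeasurable.apply {y : Ω → JointAction d} (hy : BddMeasurable m μ y) (i : Fin N) :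
    BddMeasurable m μ fun ω => y ω i :=
  hy.comp_continuous (PiLp.continuous_apply 2 _ i)

theorem BddMeasurable.of_apply {y : Ω → JointAction d}
    (hy : ∀ i, BddMeasurable m μ fun ω => y ω i) : BddMeasurable m μ y := by
  refine ⟨?_, ?_⟩
  · have hpi : Measurable[m] fun ω => WithLp.ofLp (y ω) :=
      (@measurable_pi_iff _ _ _ m _ _).2 fun i => (hy i).stronglyMeasurable.measurable
    exact ((WithLp.measurable_toLp 2 _).comp hpi).stronglyMeasurable
  · obtain ⟨C, hC⟩ := (BddMeasurable.sum univ fun i _ => (hy i).norm_sq).exists_bound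
    refine ⟨√C, hC.mono fun ω hω => Real.le_sqrt_of_sq_le ?_⟩
    rw [PiLp.norm_sq_eq_of_L2]
    exact (le_abs_self _).trans hω

/-- A σ-algebra `m` for which the initial point and the feedback received before round `t` are
measurable and almost surely bounded. It then also determines the action of round `t` and the step
sizes of round `t + 1`. -/
structure KnowsUntil (μ : Measure Ω) (g : ℕ → (i : Fin N) → Ω → Action d i)
    (X : ℕ → Ω → JointAction d) (m : MeasurableSpace Ω) (t : ℕ) : Prop where
  bddMeasurable_init : ∀ i, BddMeasurable m μ fun ω => X 1 ω i
  bddMeasurable_feedback : ∀ s < t, ∀ i, BddMeasurable m μ (g s i)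

namespace KnowsUntil

variable {g : ℕ → (i : Fin N) → Ω → Action d i} {s : ℕ}

theorem mono {m' : MeasurableSpace Ω} (h : KnowsUntil μ g X m t) (hm : m ≤ m') :
    KnowsUntil μ g X m' t :=
  ⟨fun i => (h.bddMeasurable_init i).mono hm,
    fun s hs i => (h.bddMeasurable_feedback s hs i).mono hm⟩

theorem bddMeasurable_sum_feedback (h : KnowsUntil μ g X m t) (hs : s < t) (i : Fin N) :
    BddMeasurable m μ fun ω => ∑ k ∈ Icc 1 s, g k i ω :=
  BddMeasurable.sum _ fun k hk => h.bddMeasurable_feedback k ((mem_Icc.1 hk).2.trans_lt hs) i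

theorem bddMeasurable_cumSq (h : KnowsUntil μ g X m t) (hs : s < t) (i : Fin N) :
    BddMeasurable m μ (cumSq g s i) :=
  BddMeasurable.sum _ fun k hk =>
    (h.bddMeasurable_feedback k ((mem_Icc.1 hk).2.trans_lt hs) i).norm_sq

theorem bddMeasurable_extrapStep (h : KnowsUntil μ g X m t) (hq : q ≤ 1 / 2) (ht : 1 ≤ t)
    (hs : s ≤ t + 1) (i : Fin N) : BddMeasurable m μ (extrapStep q g s i) := by
  refine ⟨?_, 1, ae_of_all _ fun ω => ?_⟩
  · have hcum : Measurable[m] (cumSq g (s - 2) i) :=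
      (h.bddMeasurable_cumSq (by lia) i).stronglyMeasurable.measurable
    exact (((hcum.const_add 1).pow_const (1 / 2 - q)).const_div 1).stronglyMeasurable
  · rw [Real.norm_of_nonneg extrapStep_pos.le]
    exact extrapStep_le_one hq

theorem bddMeasurable_normalizedSq (h : KnowsUntil μ g X m t) (hs : s < t) (i : Fin N) :
    BddMeasurable m μ (normalizedSq g s i) := by
  have heq : normalizedSq g s i = fun ω => ‖g s i ω‖ ^ 2 * extrapStep 0 g s i ω := by
    funext ω
    rw [normalizedSq, extrapStep, sub_zero, ← Real.sqrt_eq_rpow, mul_one_div]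
  rw [heq]
  exact (h.bddMeasurable_feedback s hs i).norm_sq.mul
    (h.bddMeasurable_extrapStep (by norm_num) (by lia) (by lia) i)

theorem bddMeasurable_stepWeight_of_iterate (h : KnowsUntil μ g X m t) (hs : s < t) (i : Fin N)
    (hX : ∀ k, 1 ≤ k → k ≤ s + 1 → BddMeasurable m μ fun ω => X k ω i) :
    BddMeasurable m μ (stepWeight g X s i) := by
  refine (((BddMeasurable.const 1).add (h.bddMeasurable_cumSq hs i)).add
    (BddMeasurable.sum _ fun k hk => ?_)).sqrt
  obtain ⟨hk1, hks⟩ := mem_Icc.1 hk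
  exact ((hX k hk1 (by lia)).sub (hX (k + 1) (by lia) (by lia))).norm_sq

theorem bddMeasurable_updateStep_of_invStep (h : BddMeasurable m μ (invStep g X s i)) :
    BddMeasurable m μ (updateStep g X s i) := by
  refine ⟨?_, 1, ae_of_all _ fun ω => ?_⟩
  · exact (h.stronglyMeasurable.measurable.const_div 1).stronglyMeasurable
  · rw [Real.norm_of_nonneg updateStep_pos.le]
    exact updateStep_le_one

theorem bddMeasurable_iterate (h : KnowsUntil μ fb X m t)
    (hrun : RunsAdaptiveOptDAPlus ℓ q ξ X x) (hs1 : 1 ≤ s) (hs : s ≤ t) (i : Fin N) :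
    BddMeasurable m μ fun ω => X s ω i := by
  induction s using Nat.strong_induction_on with
  | _ s ih =>
    obtain rfl | hs2 := hs1.eq_or_lt
    · exact h.bddMeasurable_init i
    have hρ : BddMeasurable m μ (stepρ s i) :=
      h.bddMeasurable_stepWeight_of_iterate (by lia) i fun k hk1 hk => ih k (by lia) hk1 (by lia)
    simp only [hrun.iterate_eq hs1]
    exact (h.bddMeasurable_init i).sub
      ((bddMeasurable_updateStep_of_invStep hρ).smul (h.bddMeasurable_sum_feedback (by lia) i))

theorem bddMeasurable_stepWeight (h : KnowsUntil μ fb X m t)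
    (hrun : RunsAdaptiveOptDAPlus ℓ q ξ X x) (hs : s < t) (i : Fin N) :
    BddMeasurable m μ (wt s i) :=
  h.bddMeasurable_stepWeight_of_iterate hs i fun _ hk1 hk =>
    h.bddMeasurable_iterate hrun hk1 (by lia) i

theorem bddMeasurable_invStep (h : KnowsUntil μ fb X m t)
    (hrun : RunsAdaptiveOptDAPlus ℓ q ξ X x) (ht : 1 ≤ t) (hs : s ≤ t + 1) (i : Fin N) :
    BddMeasurable m μ (stepρ s i) :=
  h.bddMeasurable_stepWeight hrun (by lia) i

theorem bddMeasurable_updateStep (h : KnowsUntil μ fb X m t)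
    (hrun : RunsAdaptiveOptDAPlus ℓ q ξ X x) (ht : 1 ≤ t) (hs : s ≤ t + 1) (i : Fin N) :
    BddMeasurable m μ (stepη s i) :=
  bddMeasurable_updateStep_of_invStep (h.bddMeasurable_invStep hrun ht hs i)

theorem bddMeasurable_play (h : KnowsUntil μ fb X m t) (hrun : RunsAdaptiveOptDAPlus ℓ q ξ X x)
    (hq : q ≤ 1 / 2) (hs1 : 1 ≤ s) (hs : s ≤ t) : BddMeasurable m μ (x s) := by
  refine BddMeasurable.of_apply fun i => ?_
  simp only [hrun.extrapolate s hs1]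
  exact (h.bddMeasurable_iterate hrun hs1 hs i).sub
    ((h.bddMeasurable_extrapStep hq (hs1.trans hs) (by lia) i).smul
      (h.bddMeasurable_feedback _ (by lia) i))

theorem bddMeasurable_indivGrad (h : KnowsUntil μ fb X m t)
    (hrun : RunsAdaptiveOptDAPlus ℓ q ξ X x) (hq : q ≤ 1 / 2) (hsm : ConvexSmooth ℓ L)
    (hs1 : 1 ≤ s) (hs : s ≤ t) (i : Fin N) :
    BddMeasurable m μ fun ω => indivGrad ℓ i (x s ω) :=
  (h.bddMeasurable_play hrun hq hs1 hs).comp_continuous (hsm.lipschitz i).continuous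

theorem bddMeasurable_denoised (h : KnowsUntil μ fb X m t)
    (hrun : RunsAdaptiveOptDAPlus ℓ q ξ X x) (hq : q ≤ 1 / 2) (hsm : ConvexSmooth ℓ L)
    (ht : 1 ≤ t) : BddMeasurable m μ (denoised ℓ q ξ X x t) := by
  refine BddMeasurable.of_apply fun i => ?_
  have hη := h.bddMeasurable_updateStep hrun ht le_rfl i
  exact ((h.bddMeasurable_init i).sub
    (hη.smul (h.bddMeasurable_sum_feedback (Nat.sub_lt ht one_pos) i))).sub
      ((hη.add (h.bddMeasurable_extrapStep hq ht le_rfl i)).smul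
        (h.bddMeasurable_indivGrad hrun hq hsm ht le_rfl i))

theorem bddMeasurable_regretDirection (h : KnowsUntil μ fb X m t)
    (hrun : RunsAdaptiveOptDAPlus ℓ q ξ X x) (hq : q ≤ 1 / 2) (p : JointAction d) (ht : 1 ≤ t)
    (i : Fin N) : BddMeasurable m μ (regretDirection fb q x p t i) :=
  ((BddMeasurable.const _).smul (((h.bddMeasurable_play hrun hq ht le_rfl).apply i).sub
    (BddMeasurable.const _))).add
    (((BddMeasurable.const _).mul (h.bddMeasurable_extrapStep hq ht (Nat.le_succ t) i)).smul
      (h.bddMeasurable_feedback _ (Nat.sub_lt ht one_pos) i))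

theorem bddMeasurable_crossDirection (h : KnowsUntil μ fb X m t)
    (hrun : RunsAdaptiveOptDAPlus ℓ q ξ X x) (hq : q ≤ 1 / 2) (hsm : ConvexSmooth ℓ L)
    (ht : 1 ≤ t) (i : Fin N) : BddMeasurable m μ (crossDirection ℓ L q ξ X x t i) := by
  have hγ := h.bddMeasurable_extrapStep hq ht le_rfl i
  exact (((BddMeasurable.const _).mul hγ).smul ((h.bddMeasurable_denoised hrun hq hsm
    ht).comp_continuous (hsm.lipschitz i).continuous)).add
    (((BddMeasurable.const _).mul (hγ.pow 2)).smul
      (h.bddMeasurable_indivGrad hrun hq hsm ht le_rfl i))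

theorem bddMeasurable_pathSq (h : KnowsUntil μ fb X m t)
    (hrun : RunsAdaptiveOptDAPlus ℓ q ξ X x) (hs : s < t) (i : Fin N) :
    BddMeasurable m μ (pathSq X s i) := by
  refine BddMeasurable.sum _ fun k hk => ?_
  obtain ⟨hk1, hks⟩ := mem_Icc.1 hk
  exact ((h.bddMeasurable_iterate hrun hk1 (by lia) i).sub
    (h.bddMeasurable_iterate hrun (by lia) (by lia) i)).norm_sq

theorem bddMeasurable_weightedDist (h : KnowsUntil μ fb X m t)
    (hrun : RunsAdaptiveOptDAPlus ℓ q ξ X x) (p : JointAction d) (hs1 : 1 ≤ s) (hs : s ≤ t)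
    (i : Fin N) : BddMeasurable m μ (weightedDist fb X p s i) :=
  (h.bddMeasurable_invStep hrun (hs1.trans hs) (by lia) i).mul
    ((h.bddMeasurable_iterate hrun hs1 hs i).sub (BddMeasurable.const _)).norm_sq

/- The action of round `t + 1` is the denoised action minus a positive multiple of the noise of
round `t`, so observing it reveals the feedback of round `t`. -/
theorem stronglyMeasurable_feedback (h : KnowsUntil μ fb X m t)
    (hrun : RunsAdaptiveOptDAPlus ℓ q ξ X x) (hq : q ≤ 1 / 2) (ht : 1 ≤ t)
    (hx : StronglyMeasurable[m] fun ω => x (t + 1) ω i) : StronglyMeasurable[m] (fb t i) := by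
  have hη := h.bddMeasurable_updateStep hrun ht le_rfl i
  have hγ := h.bddMeasurable_extrapStep hq ht le_rfl i
  have hS := h.bddMeasurable_sum_feedback (Nat.sub_lt ht one_pos) i
  have hfb : fb t i = fun ω => (stepη (t + 1) i ω + stepγ (t + 1) i ω)⁻¹ •
      (X 1 ω i - stepη (t + 1) i ω • ∑ k ∈ Icc 1 (t - 1), fb k i ω - x (t + 1) ω i) := by
    funext ω
    have hpos : 0 < stepη (t + 1) i ω + stepγ (t + 1) i ω := add_pos updateStep_pos extrapStep_pos
    rw [eq_inv_smul_iff₀ hpos.ne', hrun.play_succ_eq ht, denoised, feedback_of_pos ht]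
    simp only
    module
  rw [hfb]
  exact (hη.add hγ).stronglyMeasurable.measurable.inv.stronglyMeasurable.smul
    (((h.bddMeasurable_init i).sub (hη.smul hS)).stronglyMeasurable.sub hx)

end KnowsUntil

theorem playHistory_mono : Monotone (playHistory x) :=
  fun _ _ hst => biSup_mono fun _ hs => ⟨hs.1, hs.2.trans hst⟩

theorem stronglyMeasurable_play {s : ℕ} (hs1 : 1 ≤ s) (hst : s ≤ t) :
    StronglyMeasurable[playHistory x t] (x s) := by
  have hle : MeasurableSpace.comap (x s) (borel (JointAction d)) ≤ playHistory x t :=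
    le_iSup₂_of_le s ⟨hs1, hst⟩ le_rfl
  rw [← BorelSpace.measurable_eq (α := JointAction d)] at hle
  exact (measurable_iff_comap_le.2 hle).stronglyMeasurable

theorem stronglyMeasurable_play_apply {s : ℕ} (hs1 : 1 ≤ s) (hst : s ≤ t) (i : Fin N) :
    StronglyMeasurable[playHistory x t] fun ω => x s ω i :=
  (PiLp.continuous_apply 2 _ i).comp_stronglyMeasurable (stronglyMeasurable_play hs1 hst)

theorem RunsAdaptiveOptDAPlus.play_one_eq (hrun : RunsAdaptiveOptDAPlus ℓ q ξ X x) :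
    x 1 ω i = X 1 ω i := by
  rw [hrun.extrapolate 1 le_rfl, Nat.sub_self, feedback_zero, smul_zero, sub_zero]

/-- The standing assumptions on the game, the noise and the learning algorithm. -/
structure NoisyRun (μ : Measure Ω) (ℓ : Fin N → JointAction d → ℝ) (L : ℝ≥0)
    (σM G B q R : ℝ) (ξ : ℕ → (i : Fin N) → Ω → Action d i) (X x : ℕ → Ω → JointAction d) :
    Prop where
  q_pos : 0 < q
  q_le : q ≤ 1 / 4
  smooth : ConvexSmooth ℓ L
  stable : VariationallyStable ℓ
  noise : NoiseModel μ ℓ x ξ 0 σM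
  bounded : BoundedFeedback μ ℓ ξ G B
  measurable_init : Measurable (X 1)
  init_le : ∀ᵐ ω ∂μ, ‖X 1 ω‖ ≤ R
  run : RunsAdaptiveOptDAPlus ℓ q ξ X x

namespace NoisyRun

theorem q_le_half (h : NoisyRun μ ℓ L σM G B q R ξ X x) : q ≤ 1 / 2 :=
  h.q_le.trans (by norm_num)

theorem bddMeasurable_noise (h : NoisyRun μ ℓ L σM G B q R ξ X x) (ht : 1 ≤ t) (i : Fin N) :
    BddMeasurable m0 μ (ξ t i) :=
  ⟨(h.noise.measurable t ht i).stronglyMeasurable, B, h.bounded.noise_le t ht i⟩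

theorem ae_norm_feedback_le (h : NoisyRun μ ℓ L σM G B q R ξ X x) :
    ∀ᵐ ω ∂μ, ∀ i t, ‖fb t i ω‖ ≤ |G| + |B| := by
  refine ae_all_iff.2 fun i => ae_all_iff.2 fun t => ?_
  obtain rfl | ht := Nat.eq_zero_or_pos t
  · exact ae_of_all _ fun ω => by rw [feedback_zero, norm_zero]; positivity
  · filter_upwards [h.bounded.noise_le t ht i] with ω hω
    rw [feedback_of_pos ht]
    exact (norm_add_le _ _).trans
      (add_le_add ((h.bounded.grad_le i _).trans (le_abs_self G)) (hω.trans (le_abs_self B)))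

theorem knowsUntil_ambient (h : NoisyRun μ ℓ L σM G B q R ξ X x) (t : ℕ) :
    KnowsUntil μ fb X m0 t := by
  induction t with
  | zero =>
    refine ⟨?_, fun s hs => absurd hs (Nat.not_lt_zero s)⟩
    exact BddMeasurable.apply ⟨h.measurable_init.stronglyMeasurable, R, h.init_le⟩
  | succ t ih =>
    refine ⟨ih.bddMeasurable_init, fun s hs i => ?_⟩
    obtain hs | rfl := Nat.lt_succ_iff_lt_or_eq.1 hs
    · exact ih.bddMeasurable_feedback s hs i
    obtain rfl | hs1 := Nat.eq_zero_or_pos s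
    · exact BddMeasurable.const 0
    · rw [show fb s i = fun ω => indivGrad ℓ i (x s ω) + ξ s i ω from
        funext fun _ => feedback_of_pos hs1]
      exact (ih.bddMeasurable_indivGrad h.run h.q_le_half h.smooth hs1 le_rfl i).add
        (h.bddMeasurable_noise hs1 i)

theorem playHistory_le (h : NoisyRun μ ℓ L σM G B q R ξ X x) (t : ℕ) : playHistory x t ≤ m0 := by
  refine iSup₂_le fun s hs => ?_
  rw [← BorelSpace.measurable_eq (α := JointAction d)]
  exact ((h.knowsUntil_ambient s).bddMeasurable_play h.run h.q_le_half hs.1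
    le_rfl).stronglyMeasurable.measurable.comap_le

theorem knowsUntil (h : NoisyRun μ ℓ L σM G B q R ξ X x) (ht : 1 ≤ t) :
    KnowsUntil μ fb X (playHistory x t) t := by
  induction t, ht using Nat.le_induction with
  | base =>
    refine ⟨fun i => ⟨?_, ((h.knowsUntil_ambient 1).bddMeasurable_init i).exists_bound⟩,
      fun s hs i => ?_⟩
    · simp only [← h.run.play_one_eq]
      exact stronglyMeasurable_play_apply le_rfl le_rfl i
    · obtain rfl : s = 0 := by lia
      exact BddMeasurable.const 0
  | succ t ht ih =>
    have hsucc := ih.mono (playHistory_mono (Nat.le_succ t))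
    refine ⟨hsucc.bddMeasurable_init, fun s hs i => ?_⟩
    obtain hs | rfl := Nat.lt_succ_iff_lt_or_eq.1 hs
    · exact hsucc.bddMeasurable_feedback s hs i
    · exact ⟨hsucc.stronglyMeasurable_feedback h.run h.q_le_half ht
        (stronglyMeasurable_play_apply (by lia) le_rfl i), |G| + |B|,
        h.ae_norm_feedback_le.mono fun _ hω => hω i s⟩

end NoisyRun

/-! ### The energy inequality -/

/-- The energy `∑ₜ ∑ᵢ γⁱ_t ‖Vⁱ(x_t)‖²` of the gradients of the first `T` rounds. -/
def gradEnergy (ℓ : Fin N → JointAction d → ℝ) (q : ℝ) (ξ : ℕ → (i : Fin N) → Ω → Action d i)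
    (x : ℕ → Ω → JointAction d) (T : ℕ) (ω : Ω) : ℝ :=
  ∑ t ∈ Icc 1 T, ∑ i, extrapStep q (feedback ℓ x ξ) t i ω * ‖indivGrad ℓ i (x t ω)‖ ^ 2

/-- The energy `∑ₜ ∑ᵢ γⁱ_t ‖gⁱ_t‖²` of the feedback of the first `T` rounds. -/
def feedbackEnergy (q : ℝ) (g : ℕ → (i : Fin N) → Ω → Action d i) (T : ℕ) (ω : Ω) : ℝ :=
  ∑ t ∈ Icc 1 T, ∑ i, extrapStep q g t i ω * ‖g t i ω‖ ^ 2

/-- The sum of all terms of the energy inequality of the first `T` rounds that are linear in the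
noise. -/
def noiseSum (ℓ : Fin N → JointAction d → ℝ) (L : ℝ≥0) (q : ℝ)
    (ξ : ℕ → (i : Fin N) → Ω → Action d i) (X x : ℕ → Ω → JointAction d) (p : JointAction d)
    (T : ℕ) (ω : Ω) : ℝ :=
  ∑ t ∈ Icc 1 T, ∑ i, inner ℝ (ξ t i ω) (regretDirection (feedback ℓ x ξ) q x p t i ω) +
    ∑ t ∈ Icc 1 (T - 1), ∑ i, inner ℝ (ξ t i ω) (crossDirection ℓ L q ξ X x t i ω)

theorem gradEnergy_nonneg (T : ℕ) : 0 ≤ gradEnergy ℓ q ξ x T ω :=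
  sum_nonneg fun _ _ => sum_nonneg fun _ _ => mul_nonneg extrapStep_pos.le (by positivity)

theorem gradEnergy_mono : Monotone fun T => gradEnergy ℓ q ξ x T ω := fun _ _ hst =>
  sum_Icc_one_le_sum_Icc_one
    (a := fun t => ∑ i, stepγ t i ω * ‖indivGrad ℓ i (x t ω)‖ ^ 2)
    (fun _ => sum_nonneg fun _ _ => mul_nonneg extrapStep_pos.le (by positivity)) hst

theorem RunsAdaptiveOptDAPlus.sum_movement_add_correlation_le
    (hrun : RunsAdaptiveOptDAPlus ℓ q ξ X x) (hst : VariationallyStable ℓ) (hp : IsNash ℓ p)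
    (T : ℕ) :
    ∑ t ∈ Icc 1 T, ∑ i, (3 / 4 * (stepρ t i ω * ‖X t ω i - X (t + 1) ω i‖ ^ 2) +
        2 * stepγ t i ω * inner ℝ (indivGrad ℓ i (x t ω)) (fb (t - 1) i ω)) ≤
      ∑ i, wt T i ω * ‖X 1 ω i - p i‖ ^ 2 + ∑ t ∈ Icc 1 T, ∑ i, (4 * nsq t i ω +
        inner ℝ (ξ t i ω) (regretDirection fb q x p t i ω)) := by
  have htelescope := le_add_sum_Icc_one_of_succ_le
    (a := fun t => ∑ i, (weightedDist fb X p t i ω - stepρ t i ω * ‖X 1 ω i - p i‖ ^ 2))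
    (b := fun t => ∑ i, (4 * nsq t i ω + inner ℝ (ξ t i ω) (regretDirection fb q x p t i ω)) -
      ∑ i, (3 / 4 * (stepρ t i ω * ‖X t ω i - X (t + 1) ω i‖ ^ 2) +
        2 * stepγ t i ω * inner ℝ (indivGrad ℓ i (x t ω)) (fb (t - 1) i ω)))
    (fun t ht => by
      have hdescent := hrun.sum_weightedDist_succ_le hst hp ht (ω := ω)
      simp only [sum_add_distrib, sum_sub_distrib, sub_mul] at hdescent ⊢
      linarith) T
  have hinit : ∑ i, (weightedDist fb X p 1 i ω - stepρ 1 i ω * ‖X 1 ω i - p i‖ ^ 2) = 0 :=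
    sum_eq_zero fun i _ => sub_self _
  have hlast : -∑ i, wt T i ω * ‖X 1 ω i - p i‖ ^ 2 ≤
      ∑ i, (weightedDist fb X p (T + 1) i ω - stepρ (T + 1) i ω * ‖X 1 ω i - p i‖ ^ 2) := by
    rw [← sum_neg_distrib]
    refine sum_le_sum fun i _ => ?_
    have hρ : stepρ (T + 1) i ω * ‖X 1 ω i - p i‖ ^ 2 ≤ wt T i ω * ‖X 1 ω i - p i‖ ^ 2 := by
      gcongr
      exact invStep_succ_le_stepWeight
    linarith [weightedDist_nonneg (X := X) (p := p) (g := fb) (t := T + 1) (i := i) (ω := ω)]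
  rw [hinit, zero_add, sum_sub_distrib (s := Icc 1 T)] at htelescope
  linarith

theorem RunsAdaptiveOptDAPlus.gradEnergy_sub_correlation_le
    (hrun : RunsAdaptiveOptDAPlus ℓ q ξ X x) (hsm : ConvexSmooth ℓ L)
    (hG : ∀ i y, ‖indivGrad ℓ i y‖ ≤ G) (hq0 : 0 ≤ q) (hq : q ≤ 1 / 4) (T : ℕ) :
    gradEnergy ℓ q ξ x T ω - ∑ t ∈ Icc 1 T, ∑ i,
        2 * stepγ t i ω * inner ℝ (indivGrad ℓ i (x t ω)) (fb (t - 1) i ω) ≤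
      N * G ^ 2 + ∑ t ∈ Icc 1 (T - 1), (crossError ℓ L G ξ X x t ω +
        ∑ i, inner ℝ (ξ t i ω) (crossDirection ℓ L q ξ X x t i ω)) := by
  simp only [gradEnergy, ← sum_sub_distrib]
  refine sum_Icc_one_le_add_sum_Icc_pred (by positivity) ?_
    (fun t ht => hrun.sum_extrapStep_mul_le_crossError hsm hG hq0 hq ht) T
  have hfirst : ∀ i, stepγ 1 i ω * ‖indivGrad ℓ i (x 1 ω)‖ ^ 2 -
      2 * stepγ 1 i ω * inner ℝ (indivGrad ℓ i (x 1 ω)) (fb (1 - 1) i ω) ≤ G ^ 2 := fun i =>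
    calc _ = stepγ 1 i ω * ‖indivGrad ℓ i (x 1 ω)‖ ^ 2 := by
          rw [Nat.sub_self, feedback_zero, inner_zero_right, mul_zero, sub_zero]
      _ ≤ 1 * G ^ 2 := by
          gcongr
          · exact extrapStep_le_one (hq.trans (by norm_num))
          · exact hG i _
      _ = G ^ 2 := one_mul _
  simpa using sum_le_sum fun i (_ : i ∈ univ) => hfirst i

theorem sum_normalizedSq_feedback_add_pred_le {M : ℝ} (hM : ∀ t, ‖fb t i ω‖ ≤ M) (T : ℕ) :
    ∑ t ∈ Icc 1 T, (nsq t i ω + nsq (t - 1) i ω) ≤ 4 * √(1 + 2 * M ^ 2) * wt T i ω := by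
  have hpred := sum_Icc_one_pred_le (a := fun t => nsq t i ω) (fun _ => normalizedSq_nonneg)
    (by simp [normalizedSq, feedback_zero]) T
  rw [sum_add_distrib]
  linarith [sum_normalizedSq_le (X := X) hM T]

theorem sum_min_sub_invStep_mul_le {A K : ℝ} (hA : 0 ≤ A) (hK : 0 ≤ K) (T : ℕ) :
    ∑ t ∈ Icc 1 T, (min A (K * ‖X t ω i - X (t + 1) ω i‖ ^ 2) -
      1 / 2 * (stepρ t i ω * ‖X t ω i - X (t + 1) ω i‖ ^ 2)) ≤ 4 * K ^ 3 + 2 * A := by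
  refine (sum_le_sum fun t _ => ?_).trans (sum_min_sub_mul_sqrt_delayed_le
    (a := fun t => ‖X t ω i - X (t + 1) ω i‖ ^ 2) (fun _ => by positivity) hA hK T)
  have hρ : √(1 + pathSq X (t - 2) i ω) ≤ stepρ t i ω := sqrt_one_add_pathSq_le_stepWeight
  rw [← pathSq]
  nlinarith [mul_le_mul_of_nonneg_left hρ (sq_nonneg ‖X t ω i - X (t + 1) ω i‖)]

theorem crossError_nonneg : 0 ≤ crossError ℓ L G ξ X x t ω :=
  sum_nonneg fun _ _ => add_nonneg
    (mul_nonneg N.cast_nonneg (le_min (by positivity) (by positivity)))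
    (mul_nonneg (by positivity) (add_nonneg normalizedSq_nonneg normalizedSq_nonneg))

theorem sum_crossError_le {M : ℝ} (hM : ∀ i t, ‖fb t i ω‖ ≤ M) (T : ℕ) :
    ∑ t ∈ Icc 1 T, crossError ℓ L G ξ X x t ω ≤
      ∑ t ∈ Icc 1 T, ∑ i, 1 / 2 * (stepρ t i ω * ‖X t ω i - X (t + 1) ω i‖ ^ 2) +
      N * (4 * (3 * N * L ^ 2) ^ 3 + 8 * N * G ^ 2) +
      (3 * L ^ 2 * N + L * (4 * N + 1)) * (4 * √(1 + 2 * M ^ 2)) * ∑ i, wt T i ω := by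
  have hplayer : ∀ i, ∑ t ∈ Icc 1 T,
      (N * min (4 * G ^ 2) (3 * L ^ 2 * ‖X t ω i - X (t + 1) ω i‖ ^ 2) +
        (3 * L ^ 2 * N + L * (4 * N + 1)) * (nsq t i ω + nsq (t - 1) i ω)) ≤
      ∑ t ∈ Icc 1 T, 1 / 2 * (stepρ t i ω * ‖X t ω i - X (t + 1) ω i‖ ^ 2) +
        (4 * (3 * N * L ^ 2) ^ 3 + 8 * N * G ^ 2) +
        (3 * L ^ 2 * N + L * (4 * N + 1)) * (4 * √(1 + 2 * M ^ 2)) * wt T i ω := by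
    intro i
    have hmove := sum_min_sub_invStep_mul_le (ℓ := ℓ) (ξ := ξ) (X := X) (x := x) (i := i) (ω := ω)
      (A := N * (4 * G ^ 2)) (K := N * (3 * L ^ 2)) (by positivity) (by positivity) T
    have hnsq := mul_le_mul_of_nonneg_left (sum_normalizedSq_feedback_add_pred_le (X := X) (hM i) T)
      (by positivity : 0 ≤ 3 * (L : ℝ) ^ 2 * N + L * (4 * N + 1))
    rw [sum_sub_distrib] at hmove
    simp only [mul_min_of_nonneg _ _ (Nat.cast_nonneg (α := ℝ) N), ← mul_assoc] at hmove hnsq ⊢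
    rw [sum_add_distrib, ← mul_sum]
    linarith
  simp only [crossError]
  rw [sum_comm, sum_comm (t := univ) (s := Icc 1 T)
    (f := fun t i => 1 / 2 * (stepρ t i ω * ‖X t ω i - X (t + 1) ω i‖ ^ 2))]
  refine (sum_le_sum fun i _ => hplayer i).trans_eq ?_
  rw [sum_add_distrib, sum_add_distrib, sum_const, card_univ, Fintype.card_fin, nsmul_eq_mul,
    mul_sum]

theorem norm_init_sub_sq_le (hR : ‖X 1 ω‖ ≤ R) (p : JointAction d) (i : Fin N) :
    ‖X 1 ω i - p i‖ ^ 2 ≤ (R + ‖p‖) ^ 2 := by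
  gcongr
  calc ‖X 1 ω i - p i‖ = ‖(X 1 ω - p) i‖ := rfl
    _ ≤ ‖X 1 ω - p‖ := PiLp.norm_apply_le _ i
    _ ≤ R + ‖p‖ := (norm_sub_le _ _).trans (add_le_add_left hR _)

theorem NoisyRun.exists_gradEnergy_add_pathSq_le (h : NoisyRun μ ℓ L σM G B q R ξ X x)
    (hp : IsNash ℓ p) :
    ∃ C₀ C₁ : ℝ, 0 ≤ C₁ ∧ ∀ᵐ ω ∂μ, ∀ T,
      gradEnergy ℓ q ξ x T ω + 1 / 4 * ∑ i, pathSq X T i ω ≤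
        C₀ + C₁ * ∑ i, wt T i ω + noiseSum ℓ L q ξ X x p T ω := by
  set κ := 4 * √(1 + 2 * (|G| + |B|) ^ 2)
  set c := 3 * (L : ℝ) ^ 2 * N + L * (4 * N + 1)
  refine ⟨N * G ^ 2 + N * (4 * (3 * N * L ^ 2) ^ 3 + 8 * N * G ^ 2), (R + ‖p‖) ^ 2 + 2 * κ + c * κ,
    by positivity, ?_⟩
  filter_upwards [h.ae_norm_feedback_le, h.init_le] with ω hM hR T
  have hdescent := h.run.sum_movement_add_correlation_le h.stable hp T (ω := ω)
  have hcorr := h.run.gradEnergy_sub_correlation_le h.smooth h.bounded.grad_le h.q_pos.le h.q_le T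
    (ω := ω)
  have hcross := (sum_Icc_one_le_sum_Icc_one (a := fun t => crossError ℓ L G ξ X x t ω)
    (fun _ => crossError_nonneg) (Nat.sub_le T 1)).trans (sum_crossError_le hM T)
  have hinit : ∑ i, wt T i ω * ‖X 1 ω i - p i‖ ^ 2 ≤ (R + ‖p‖) ^ 2 * ∑ i, wt T i ω := by
    rw [mul_sum]
    refine sum_le_sum fun i _ => ?_
    rw [mul_comm]
    exact mul_le_mul_of_nonneg_right (norm_init_sub_sq_le hR p i) stepWeight_nonneg
  have hnsq : ∑ t ∈ Icc 1 T, ∑ i, 4 * nsq t i ω ≤ 2 * κ * ∑ i, wt T i ω := by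
    rw [sum_comm, mul_sum]
    refine sum_le_sum fun i _ => ?_
    rw [← mul_sum]
    linarith [sum_normalizedSq_le (X := X) (hM i) T]
  have hpath : ∑ i, pathSq X T i ω ≤
      ∑ t ∈ Icc 1 T, ∑ i, stepρ t i ω * ‖X t ω i - X (t + 1) ω i‖ ^ 2 := by
    rw [sum_comm]
    exact sum_le_sum fun i _ => sum_le_sum fun t _ =>
      le_mul_of_one_le_left (by positivity) one_le_stepWeight
  rw [noiseSum]
  simp only [sum_add_distrib, ← mul_sum] at hdescent hcorr hcross hinit hnsq hpath ⊢
  linarith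

theorem add_le_of_absorption {a v p w s ε C₀ C₁ C₂ : ℝ} (ha : 0 ≤ a) (hp : 0 ≤ p) (hs : 1 ≤ s)
    (hC₁ : 0 ≤ C₁) (hε : ε = 1 / (8 * s * (1 + C₁))) (henergy : a + 1 / 4 * p ≤ C₀ + C₁ * w)
    (hw : w ≤ ε * v + ε * p + C₂) (hv : v ≤ s * a) :
    a + p ≤ 8 * (C₀ + C₁ * C₂) ∧ w ≤ 8 * (C₀ + C₁ * C₂) + C₂ := by
  have hε0 : 0 < ε := by rw [hε]; positivity
  have hεs : ε * s * (1 + C₁) = 1 / 8 := by rw [hε]; field_simp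
  have hεC : 0 ≤ ε * s * C₁ := by positivity
  have hw' : w ≤ ε * s * (a + p) + C₂ := by
    nlinarith [mul_le_mul_of_nonneg_left hv hε0.le,
      mul_le_mul_of_nonneg_left (le_mul_of_one_le_left hp hs) hε0.le]
  have hC₁w : C₁ * w ≤ 1 / 8 * (a + p) + C₁ * C₂ := by
    nlinarith [mul_le_mul_of_nonneg_left hw' hC₁, mul_nonneg hε0.le (add_nonneg ha hp)]
  have hsum : a + p ≤ 8 * (C₀ + C₁ * C₂) := by linarith
  exact ⟨hsum, by nlinarith [add_nonneg ha hp]⟩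

namespace NoisyRun

theorem bddMeasurable_regretDirection (h : NoisyRun μ ℓ L σM G B q R ξ X x) (p : JointAction d)
    (ht : 1 ≤ t) (i : Fin N) :
    BddMeasurable (playHistory x t) μ (regretDirection fb q x p t i) :=
  (h.knowsUntil ht).bddMeasurable_regretDirection h.run h.q_le_half p ht i

theorem bddMeasurable_crossDirection (h : NoisyRun μ ℓ L σM G B q R ξ X x) (ht : 1 ≤ t)
    (i : Fin N) : BddMeasurable (playHistory x t) μ (crossDirection ℓ L q ξ X x t i) :=
  (h.knowsUntil ht).bddMeasurable_crossDirection h.run h.q_le_half h.smooth ht i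

theorem bddMeasurable_grad_term (h : NoisyRun μ ℓ L σM G B q R ξ X x) (ht : 1 ≤ t) (i : Fin N) :
    BddMeasurable m0 μ fun ω => stepγ t i ω * ‖indivGrad ℓ i (x t ω)‖ ^ 2 :=
  ((h.knowsUntil_ambient t).bddMeasurable_extrapStep h.q_le_half ht (Nat.le_succ t) i).mul
    ((h.knowsUntil_ambient t).bddMeasurable_indivGrad h.run h.q_le_half h.smooth ht le_rfl
      i).norm_sq

theorem bddMeasurable_feedback_term (h : NoisyRun μ ℓ L σM G B q R ξ X x) (ht : 1 ≤ t)
    (i : Fin N) : BddMeasurable m0 μ fun ω => stepγ t i ω * ‖fb t i ω‖ ^ 2 :=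
  ((h.knowsUntil_ambient t).bddMeasurable_extrapStep h.q_le_half ht (Nat.le_succ t) i).mul
    ((h.knowsUntil_ambient (t + 1)).bddMeasurable_feedback t (Nat.lt_succ_self t) i).norm_sq

theorem bddMeasurable_gradEnergy (h : NoisyRun μ ℓ L σM G B q R ξ X x) (T : ℕ) :
    BddMeasurable m0 μ (gradEnergy ℓ q ξ x T) :=
  BddMeasurable.sum _ fun _ ht => BddMeasurable.sum _ fun i _ =>
    h.bddMeasurable_grad_term (mem_Icc.1 ht).1 i

theorem bddMeasurable_feedbackEnergy (h : NoisyRun μ ℓ L σM G B q R ξ X x) (T : ℕ) :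
    BddMeasurable m0 μ (feedbackEnergy q fb T) :=
  BddMeasurable.sum _ fun _ ht => BddMeasurable.sum _ fun i _ =>
    h.bddMeasurable_feedback_term (mem_Icc.1 ht).1 i

theorem bddMeasurable_sum_stepWeight (h : NoisyRun μ ℓ L σM G B q R ξ X x) (T : ℕ) :
    BddMeasurable m0 μ fun ω => ∑ i, wt T i ω :=
  BddMeasurable.sum _ fun i _ =>
    (h.knowsUntil_ambient (T + 1)).bddMeasurable_stepWeight h.run (Nat.lt_succ_self T) i

theorem bddMeasurable_sum_pathSq (h : NoisyRun μ ℓ L σM G B q R ξ X x) (T : ℕ) :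
    BddMeasurable m0 μ fun ω => ∑ i, pathSq X T i ω :=
  BddMeasurable.sum _ fun i _ =>
    (h.knowsUntil_ambient (T + 1)).bddMeasurable_pathSq h.run (Nat.lt_succ_self T) i

theorem exists_sum_stepWeight_le (h : NoisyRun μ ℓ L σM G B q R ξ X x) {ε : ℝ} (hε : 0 < ε) :
    ∃ C : ℝ, ∀ T ω, ∑ i, wt T i ω ≤
      ε * feedbackEnergy q fb T ω + ε * ∑ i, pathSq X T i ω + C := by
  obtain ⟨C, hC⟩ := exists_stepWeight_le (d := d) (Ω := Ω) h.q_pos h.q_le_half hε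
  refine ⟨N * C, fun T ω => (sum_le_sum fun i _ => hC fb X T i ω).trans_eq ?_⟩
  rw [feedbackEnergy, sum_comm]
  simp only [sum_add_distrib, ← mul_sum, sum_const, card_univ, Fintype.card_fin, nsmul_eq_mul]

section FiniteMeasure

variable [IsFiniteMeasure μ]

theorem condExp_noise_inner_eq_zero (h : NoisyRun μ ℓ L σM G B q R ξ X x)
    (ht : 1 ≤ t) {Y : Ω → Action d i} (hY : BddMeasurable (playHistory x t) μ Y) :
    μ[fun ω => inner ℝ (ξ t i ω) (Y ω) | playHistory x t] =ᵐ[μ] 0 :=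
  condExp_inner_eq_zero ((h.bddMeasurable_noise ht i).integrable le_rfl)
    (h.noise.unbiased t ht i) hY.stronglyMeasurable
    (((h.bddMeasurable_noise ht i).inner (hY.mono (h.playHistory_le t))).integrable le_rfl)

theorem integrable_noise_inner (h : NoisyRun μ ℓ L σM G B q R ξ X x)
    (ht : 1 ≤ t) {Y : Ω → Action d i} (hY : BddMeasurable (playHistory x t) μ Y) :
    Integrable (fun ω => inner ℝ (ξ t i ω) (Y ω)) μ :=
  ((h.bddMeasurable_noise ht i).inner (hY.mono (h.playHistory_le t))).integrable le_rfl

theorem integral_noise_inner_eq_zero (h : NoisyRun μ ℓ L σM G B q R ξ X x)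
    (ht : 1 ≤ t) {Y : Ω → Action d i} (hY : BddMeasurable (playHistory x t) μ Y) :
    ∫ ω, inner ℝ (ξ t i ω) (Y ω) ∂μ = 0 :=
  integral_inner_eq_zero (h.playHistory_le t) ((h.bddMeasurable_noise ht i).integrable le_rfl)
    (h.noise.unbiased t ht i) hY.stronglyMeasurable (h.integrable_noise_inner ht hY)

theorem integrable_sum_noise_inner (h : NoisyRun μ ℓ L σM G B q R ξ X x) {T : ℕ}
    {Y : ℕ → (i : Fin N) → Ω → Action d i}
    (hY : ∀ t, 1 ≤ t → ∀ i, BddMeasurable (playHistory x t) μ (Y t i)) :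
    Integrable (fun ω => ∑ t ∈ Icc 1 T, ∑ i, inner ℝ (ξ t i ω) (Y t i ω)) μ :=
  integrable_finsetSum _ fun t ht => integrable_finsetSum _ fun i _ =>
    h.integrable_noise_inner (mem_Icc.1 ht).1 (hY t (mem_Icc.1 ht).1 i)

theorem integral_sum_noise_inner_eq_zero (h : NoisyRun μ ℓ L σM G B q R ξ X x) {T : ℕ}
    {Y : ℕ → (i : Fin N) → Ω → Action d i}
    (hY : ∀ t, 1 ≤ t → ∀ i, BddMeasurable (playHistory x t) μ (Y t i)) :
    ∫ ω, ∑ t ∈ Icc 1 T, ∑ i, inner ℝ (ξ t i ω) (Y t i ω) ∂μ = 0 := by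
  have hint : ∀ t ∈ Icc 1 T, ∀ i, Integrable (fun ω => inner ℝ (ξ t i ω) (Y t i ω)) μ :=
    fun t ht i => h.integrable_noise_inner (mem_Icc.1 ht).1 (hY t (mem_Icc.1 ht).1 i)
  rw [integral_finsetSum _ fun t ht => integrable_finsetSum _ fun i _ => hint t ht i]
  refine sum_eq_zero fun t ht => ?_
  rw [integral_finsetSum _ fun i _ => hint t ht i]
  exact sum_eq_zero fun i _ =>
    h.integral_noise_inner_eq_zero (mem_Icc.1 ht).1 (hY t (mem_Icc.1 ht).1 i)

theorem integrable_noiseSum (h : NoisyRun μ ℓ L σM G B q R ξ X x) (T : ℕ) :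
    Integrable (noiseSum ℓ L q ξ X x p T) μ :=
  (h.integrable_sum_noise_inner fun _ => h.bddMeasurable_regretDirection p).add
    (h.integrable_sum_noise_inner fun _ => h.bddMeasurable_crossDirection)

theorem integral_noiseSum_eq_zero (h : NoisyRun μ ℓ L σM G B q R ξ X x) (T : ℕ) :
    ∫ ω, noiseSum ℓ L q ξ X x p T ω ∂μ = 0 := by
  simp only [noiseSum]
  rw [integral_add (h.integrable_sum_noise_inner fun _ => h.bddMeasurable_regretDirection p)
      (h.integrable_sum_noise_inner fun _ => h.bddMeasurable_crossDirection),
    h.integral_sum_noise_inner_eq_zero fun _ => h.bddMeasurable_regretDirection p,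
    h.integral_sum_noise_inner_eq_zero fun _ => h.bddMeasurable_crossDirection, add_zero]

/- The step size `γⁱ_t` depends only on the feedback of rounds before `t - 1`, so it factors out of
the conditional second moment of the feedback. -/
theorem integral_feedbackEnergy_le (h : NoisyRun μ ℓ L σM G B q R ξ X x) (T : ℕ) :
    ∫ ω, feedbackEnergy q fb T ω ∂μ ≤ (1 + σM ^ 2) * ∫ ω, gradEnergy ℓ q ξ x T ω ∂μ := by
  have hgrad : ∀ t ∈ Icc 1 T, ∀ i,
      Integrable (fun ω => stepγ t i ω * ‖indivGrad ℓ i (x t ω)‖ ^ 2) μ :=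
    fun t ht i => (h.bddMeasurable_grad_term (mem_Icc.1 ht).1 i).integrable le_rfl
  have hfeedback : ∀ t ∈ Icc 1 T, ∀ i, Integrable (fun ω => stepγ t i ω * ‖fb t i ω‖ ^ 2) μ :=
    fun t ht i => (h.bddMeasurable_feedback_term (mem_Icc.1 ht).1 i).integrable le_rfl
  simp only [gradEnergy, feedbackEnergy]
  rw [integral_finsetSum _ fun t ht => integrable_finsetSum _ fun i _ => hgrad t ht i,
    integral_finsetSum _ fun t ht => integrable_finsetSum _ fun i _ => hfeedback t ht i, mul_sum]
  refine sum_le_sum fun t ht => ?_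
  rw [integral_finsetSum _ fun i _ => hgrad t ht i,
    integral_finsetSum _ fun i _ => hfeedback t ht i, mul_sum]
  refine sum_le_sum fun i _ => ?_
  have ht1 := (mem_Icc.1 ht).1
  have hknows := h.knowsUntil ht1
  simp only [feedback_of_pos ht1]
  refine integral_mul_norm_add_sq_le (h.playHistory_le t)
    (hknows.bddMeasurable_extrapStep h.q_le_half ht1 (Nat.le_succ t) i)
    (fun _ => extrapStep_pos.le)
    (hknows.bddMeasurable_indivGrad h.run h.q_le_half h.smooth ht1 le_rfl i)
    (h.bddMeasurable_noise ht1 i) (h.noise.unbiased t ht1 i) ?_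
  simpa using h.noise.variance t ht1 i

end FiniteMeasure

theorem exists_integral_le (h : NoisyRun μ ℓ L σM G B q R ξ X x) [IsProbabilityMeasure μ] :
    ∃ C : ℝ, ∀ T, ∫ ω, gradEnergy ℓ q ξ x T ω ∂μ ≤ C ∧ ∫ ω, ∑ i, wt T i ω ∂μ ≤ C := by
  obtain ⟨p, hp⟩ := h.stable.exists_nash
  obtain ⟨C₀, C₁, hC₁, henergy⟩ := h.exists_gradEnergy_add_pathSq_le hp
  set ε := 1 / (8 * (1 + σM ^ 2) * (1 + C₁)) with hε
  obtain ⟨C₂, hC₂⟩ := h.exists_sum_stepWeight_le (show 0 < ε by positivity)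
  have hgrad T := (h.bddMeasurable_gradEnergy T).integrable le_rfl
  have hfeedback T := (h.bddMeasurable_feedbackEnergy T).integrable le_rfl
  have hpath T := (h.bddMeasurable_sum_pathSq T).integrable le_rfl
  have hweight T := (h.bddMeasurable_sum_stepWeight T).integrable le_rfl
  have henergyInt : ∀ T, ∫ ω, gradEnergy ℓ q ξ x T ω ∂μ + 1 / 4 * ∫ ω, ∑ i, pathSq X T i ω ∂μ ≤
      C₀ + C₁ * ∫ ω, ∑ i, wt T i ω ∂μ := fun T => by
    have hconst := (integrable_const C₀).add ((hweight T).const_mul C₁)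
    have hmono := integral_mono_ae ((hgrad T).add ((hpath T).const_mul (1 / 4)))
      (hconst.add (h.integrable_noiseSum (p := p) T)) (henergy.mono fun ω hω => hω T)
    rwa [integral_add' (hgrad T) ((hpath T).const_mul _), integral_const_mul,
      integral_add' hconst (h.integrable_noiseSum T), h.integral_noiseSum_eq_zero, add_zero,
      integral_add' (integrable_const _) ((hweight T).const_mul _), integral_const_mul,
      integral_const, probReal_univ, one_smul] at hmono
  have hweightInt : ∀ T, ∫ ω, ∑ i, wt T i ω ∂μ ≤ ε * ∫ ω, feedbackEnergy q fb T ω ∂μ +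
      ε * ∫ ω, ∑ i, pathSq X T i ω ∂μ + C₂ := fun T => by
    have hsum := ((hfeedback T).const_mul ε).add ((hpath T).const_mul ε)
    have hmono := integral_mono (hweight T) (hsum.add (integrable_const C₂)) (hC₂ T)
    rwa [integral_add' hsum (integrable_const _), integral_add' ((hfeedback T).const_mul _)
      ((hpath T).const_mul _), integral_const_mul, integral_const_mul, integral_const,
      probReal_univ, one_smul] at hmono
  refine ⟨max (8 * (C₀ + C₁ * C₂)) (8 * (C₀ + C₁ * C₂) + C₂), fun T => ?_⟩
  have hgrad0 : 0 ≤ ∫ ω, gradEnergy ℓ q ξ x T ω ∂μ := integral_nonneg fun _ => gradEnergy_nonneg T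
  have hpath0 : 0 ≤ ∫ ω, ∑ i, pathSq X T i ω ∂μ :=
    integral_nonneg fun _ => sum_nonneg fun _ _ => pathSq_nonneg
  obtain ⟨hsum, hw⟩ := add_le_of_absorption hgrad0 hpath0 (by nlinarith) hC₁ hε
    (henergyInt T) (hweightInt T) (h.integral_feedbackEnergy_le T)
  exact ⟨le_max_of_le_left (by linarith), le_max_of_le_right hw⟩

end NoisyRun

/-! ### Almost sure convergence -/

theorem ConvexSmooth.isNash_of_indivGrad_eq_zero (hsm : ConvexSmooth ℓ L)
    (hp : ∀ i, indivGrad ℓ i p = 0) : IsNash ℓ p := fun i y => by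
  have hdeviate : deviate p i (p i) = p := by rw [deviate, Function.update_eq_self]
  simpa only [hdeviate] using apply_le_of_convexOn_of_gradient_eq_zero (hsm.convex i p)
    (hsm.differentiable i p (p i)) (hp i) y

/-- The error of the one-step descent of the weighted distance to `p` in round `t`, when the
movement of the iterates is not used to compensate the feedback. -/
def coarseError (g : ℕ → (i : Fin N) → Ω → Action d i) (q : ℝ) (X : ℕ → Ω → JointAction d)
    (p : JointAction d) (t : ℕ) (ω : Ω) : ℝ :=
  ∑ i, ((invStep g X (t + 1) i ω - invStep g X t i ω) * ‖X 1 ω i - p i‖ ^ 2 +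
    normalizedSq g t i ω + extrapStep q g t i ω * (‖g t i ω‖ ^ 2 + ‖g (t - 1) i ω‖ ^ 2))

theorem coarseError_nonneg {g : ℕ → (i : Fin N) → Ω → Action d i} :
    0 ≤ coarseError g q X p t ω :=
  sum_nonneg fun _ _ => add_nonneg (add_nonneg
    (mul_nonneg (sub_nonneg.2 (invStep_mono (Nat.le_succ t))) (by positivity)) normalizedSq_nonneg)
    (mul_nonneg extrapStep_pos.le (by positivity))

theorem sum_invStep_sub_le {g : ℕ → (i : Fin N) → Ω → Action d i} (T : ℕ) :
    ∑ t ∈ Icc 1 T, (invStep g X (t + 1) i ω - invStep g X t i ω) ≤ stepWeight g X T i ω := by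
  have htelescope := le_add_sum_Icc_one_of_succ_le (a := fun t => -invStep g X t i ω)
    (b := fun t => -(invStep g X (t + 1) i ω - invStep g X t i ω)) (fun t _ => by linarith) T
  rw [sum_neg_distrib] at htelescope
  linarith [invStep_pos (g := g) (X := X) (t := 1) (i := i) (ω := ω),
    invStep_succ_le_stepWeight (g := g) (X := X) (t := T) (i := i) (ω := ω)]

theorem sum_extrapStep_mul_feedback_add_pred_le (hq : q ≤ 1 / 2) (T : ℕ) :
    ∑ t ∈ Icc 1 T, stepγ t i ω * (‖fb t i ω‖ ^ 2 + ‖fb (t - 1) i ω‖ ^ 2) ≤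
      2 * ∑ t ∈ Icc 1 T, stepγ t i ω * ‖fb t i ω‖ ^ 2 := by
  have hpred := sum_Icc_one_pred_le (a := fun t => stepγ t i ω * ‖fb t i ω‖ ^ 2)
    (fun _ => mul_nonneg extrapStep_pos.le (by positivity)) (by simp [feedback_zero]) T
  calc ∑ t ∈ Icc 1 T, stepγ t i ω * (‖fb t i ω‖ ^ 2 + ‖fb (t - 1) i ω‖ ^ 2)
      ≤ ∑ t ∈ Icc 1 T, (stepγ t i ω * ‖fb t i ω‖ ^ 2 +
          stepγ (t - 1) i ω * ‖fb (t - 1) i ω‖ ^ 2) := by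
        simp only [mul_add]
        gcongr with t
        exact extrapStep_antitone hq (Nat.sub_le t 1)
    _ ≤ _ := by rw [sum_add_distrib]; linarith

theorem sum_coarseError_le {M : ℝ} (hq : q ≤ 1 / 2) (hM : ∀ i t, ‖fb t i ω‖ ≤ M)
    (hR : ‖X 1 ω‖ ≤ R) (p : JointAction d) (T : ℕ) :
    ∑ t ∈ Icc 1 T, coarseError fb q X p t ω ≤
      ((R + ‖p‖) ^ 2 + 2 * √(1 + 2 * M ^ 2)) * ∑ i, wt T i ω + 2 * feedbackEnergy q fb T ω := by
  simp only [coarseError, feedbackEnergy]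
  rw [sum_comm, sum_comm (s := Icc 1 T) (t := univ) (f := fun t i => stepγ t i ω * _), mul_sum,
    mul_sum, ← sum_add_distrib]
  refine sum_le_sum fun i _ => ?_
  rw [sum_add_distrib, sum_add_distrib, ← sum_mul, add_mul]
  refine add_le_add (add_le_add ?_ (sum_normalizedSq_le (hM i) T))
    (sum_extrapStep_mul_feedback_add_pred_le hq T)
  rw [mul_comm]
  exact mul_le_mul (norm_init_sub_sq_le hR p i) (sum_invStep_sub_le T)
    (sum_nonneg fun t _ => sub_nonneg.2 (invStep_mono (Nat.le_succ t))) (by positivity)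

theorem RunsAdaptiveOptDAPlus.sum_weightedDist_succ_le_coarseError
    (hrun : RunsAdaptiveOptDAPlus ℓ q ξ X x) (p : JointAction d) (ht : 1 ≤ t) :
    ∑ i, weightedDist fb X p (t + 1) i ω ≤ ∑ i, weightedDist fb X p t i ω +
      coarseError fb q X p t ω - ∑ i, 2 * inner ℝ (fb t i ω) (x t ω i - p i) := by
  rw [coarseError, ← sum_add_distrib, ← sum_sub_distrib]
  refine sum_le_sum fun i _ => ?_
  have hdescent := hrun.weightedDist_succ_le ht p one_pos (i := i) (ω := ω)
  have hcorr : -(2 * inner ℝ (fb t i ω) (fb (t - 1) i ω)) ≤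
      ‖fb t i ω‖ ^ 2 + ‖fb (t - 1) i ω‖ ^ 2 := by
    linarith [norm_add_sq_real (fb t i ω) (fb (t - 1) i ω),
      sq_nonneg ‖fb t i ω + fb (t - 1) i ω‖]
  have hγ := mul_le_mul_of_nonneg_left hcorr
    (extrapStep_pos (q := q) (g := fb) (t := t) (i := i) (ω := ω)).le
  norm_num at hdescent
  linarith

theorem RunsAdaptiveOptDAPlus.tendsto_play_sub_iterate (hrun : RunsAdaptiveOptDAPlus ℓ q ξ X x)
    (hq : q ≤ 1 / 2) (hcum : ∀ i, ∃ l, Tendsto (fun t => cumSq fb t i ω) atTop (𝓝 l)) :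
    Tendsto (fun t => x t ω - X t ω) atTop (𝓝 0) := by
  have hcoord : ∀ i, Tendsto (fun t => x t ω i - X t ω i) atTop (𝓝 0) := fun i => by
    obtain ⟨l, hl⟩ := hcum i
    refine squeeze_zero_norm' ?_ ((tendsto_norm_of_tendsto_cumSq hl).comp (tendsto_sub_atTop_nat 1))
    filter_upwards [eventually_ge_atTop 1] with t ht
    rw [hrun.extrapolate t ht, sub_sub_cancel_left, norm_neg, norm_smul,
      Real.norm_of_nonneg extrapStep_pos.le]
    exact mul_le_of_le_one_left (norm_nonneg _) (extrapStep_le_one hq)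
  exact ((PiLp.continuous_toLp 2 _).tendsto _).comp (tendsto_pi_nhds.2 hcoord)

theorem ConvexSmooth.tendsto_indivGrad_iterate (hsm : ConvexSmooth ℓ L)
    (hsub : Tendsto (fun t => x t ω - X t ω) atTop (𝓝 0))
    (hsummable : Summable fun t => ‖indivGrad ℓ i (x t ω)‖ ^ 2) :
    Tendsto (fun t => indivGrad ℓ i (X t ω)) atTop (𝓝 0) := by
  have hplay : Tendsto (fun t => indivGrad ℓ i (x t ω)) atTop (𝓝 0) := by
    rw [tendsto_zero_iff_norm_tendsto_zero]
    simpa only [Real.sqrt_sq (norm_nonneg _), Real.sqrt_zero] using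
      hsummable.tendsto_atTop_zero.sqrt
  have hdiff : Tendsto (fun t => indivGrad ℓ i (x t ω) - indivGrad ℓ i (X t ω)) atTop (𝓝 0) := by
    refine squeeze_zero_norm (fun t => (hsm.lipschitz i).norm_sub_le _ _) ?_
    simpa only [norm_zero, mul_zero] using hsub.norm.const_mul (L : ℝ)
  simpa only [sub_sub_cancel, sub_zero] using hplay.sub hdiff

theorem ConvexSmooth.isNash_of_mapClusterPt (hsm : ConvexSmooth ℓ L) {ι : Type*} {F : Filter ι}
    {Z : ι → JointAction d} (hgrad : ∀ i, Tendsto (fun t => indivGrad ℓ i (Z t)) F (𝓝 0))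
    (hp : MapClusterPt p F Z) : IsNash ℓ p :=
  hsm.isNash_of_indivGrad_eq_zero fun i =>
    have hcluster := hp.continuousAt_comp (hsm.lipschitz i).continuous.continuousAt
    eq_of_nhds_neBot (NeBot.mono hcluster (inf_le_inf_left _ (hgrad i)))

namespace NoisyRun

theorem bddMeasurable_coarseError (h : NoisyRun μ ℓ L σM G B q R ξ X x) (p : JointAction d)
    (ht : 1 ≤ t) : BddMeasurable (playHistory x (t + 1)) μ (coarseError fb q X p t) := by
  have hknows := h.knowsUntil (ht.trans (Nat.le_succ t))
  have hfb := hknows.bddMeasurable_feedback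
  refine BddMeasurable.sum _ fun i _ => ((BddMeasurable.mul ?_ ?_).add ?_).add (.mul ?_ ?_)
  · exact (hknows.bddMeasurable_invStep h.run (by lia) (by lia) i).sub
      (hknows.bddMeasurable_invStep h.run (by lia) (by lia) i)
  · exact ((hknows.bddMeasurable_init i).sub (BddMeasurable.const _)).norm_sq
  · exact hknows.bddMeasurable_normalizedSq (Nat.lt_succ_self t) i
  · exact hknows.bddMeasurable_extrapStep h.q_le_half (by lia) (by lia) i
  · exact (hfb t (by lia) i).norm_sq.add (hfb (t - 1) (by lia) i).norm_sq

theorem bddMeasurable_regret (h : NoisyRun μ ℓ L σM G B q R ξ X x) (p : JointAction d)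
    (ht : 1 ≤ t) : BddMeasurable m0 μ fun ω => ∑ i, 2 * inner ℝ (fb t i ω) (x t ω i - p i) := by
  have hknows := h.knowsUntil_ambient (t + 1)
  exact BddMeasurable.sum _ fun i _ => (BddMeasurable.const _).mul
    ((hknows.bddMeasurable_feedback t (by lia) i).inner
      (((hknows.bddMeasurable_play h.run h.q_le_half ht (by lia)).apply i).sub
        (BddMeasurable.const _)))

section FiniteMeasure

variable [IsFiniteMeasure μ]

theorem condExp_regret_nonneg (h : NoisyRun μ ℓ L σM G B q R ξ X x) (hp : IsNash ℓ p)
    (ht : 1 ≤ t) :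
    0 ≤ᵐ[μ] μ[fun ω => ∑ i, 2 * inner ℝ (fb t i ω) (x t ω i - p i) | playHistory x t] := by
  have hknows := h.knowsUntil ht
  have hm := h.playHistory_le t
  have hdisp : ∀ i, BddMeasurable (playHistory x t) μ fun ω => (2 : ℝ) • (x t ω i - p i) :=
    fun i => (BddMeasurable.const _).smul
      (((hknows.bddMeasurable_play h.run h.q_le_half ht le_rfl).apply i).sub
        (BddMeasurable.const _))
  have hdrift : BddMeasurable (playHistory x t) μ
      (fun ω => ∑ i, inner ℝ (indivGrad ℓ i (x t ω)) ((2 : ℝ) • (x t ω i - p i))) :=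
    BddMeasurable.sum _ fun i _ =>
      (hknows.bddMeasurable_indivGrad h.run h.q_le_half h.smooth ht le_rfl i).inner (hdisp i)
  have hnoise : ∀ i, Integrable (fun ω => inner ℝ (ξ t i ω) ((2 : ℝ) • (x t ω i - p i))) μ :=
    fun i => h.integrable_noise_inner ht (hdisp i)
  have hsplit : (fun ω => ∑ i, 2 * inner ℝ (fb t i ω) (x t ω i - p i)) =
      (fun ω => ∑ i, inner ℝ (indivGrad ℓ i (x t ω)) ((2 : ℝ) • (x t ω i - p i))) +
        ∑ i, fun ω => inner ℝ (ξ t i ω) ((2 : ℝ) • (x t ω i - p i)) := by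
    funext ω
    simp only [feedback_of_pos ht, Pi.add_apply, Finset.sum_apply, ← sum_add_distrib,
      inner_smul_right, inner_add_left, mul_add]
  rw [hsplit]
  filter_upwards [condExp_add (hdrift.integrable hm)
      (integrable_finsetSum' univ fun i _ => hnoise i) (playHistory x t),
    condExp_finsetSum (s := univ) (fun i _ => hnoise i) (playHistory x t),
    ae_all_iff.2 fun i => h.condExp_noise_inner_eq_zero ht (hdisp i)] with ω hadd hsum hzero
  rw [hadd, Pi.add_apply, hsum, condExp_of_stronglyMeasurable hm hdrift.stronglyMeasurable
    (hdrift.integrable hm), Finset.sum_apply, sum_eq_zero fun i _ => hzero i, add_zero]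
  simpa only [Pi.zero_apply, inner_smul_right, ← mul_sum] using
    mul_nonneg zero_le_two (h.stable.sum_inner_nonneg hp (x t ω))

end FiniteMeasure

variable [IsProbabilityMeasure μ]

theorem exists_integral_sum_coarseError_le (h : NoisyRun μ ℓ L σM G B q R ξ X x)
    (p : JointAction d) :
    ∃ C : ℝ, ∀ T, ∫ ω, ∑ t ∈ Icc 1 T, coarseError fb q X p t ω ∂μ ≤ C := by
  obtain ⟨C, hC⟩ := h.exists_integral_le
  set κ := (R + ‖p‖) ^ 2 + 2 * √(1 + 2 * (|G| + |B|) ^ 2)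
  refine ⟨κ * C + 2 * ((1 + σM ^ 2) * C), fun T => ?_⟩
  have hweight := ((h.bddMeasurable_sum_stepWeight T).integrable le_rfl).const_mul κ
  have hfeedback := ((h.bddMeasurable_feedbackEnergy T).integrable le_rfl).const_mul 2
  calc ∫ ω, ∑ t ∈ Icc 1 T, coarseError fb q X p t ω ∂μ
      ≤ ∫ ω, (κ * ∑ i, wt T i ω + 2 * feedbackEnergy q fb T ω) ∂μ := by
        refine integral_mono_ae (integrable_finsetSum _ fun t ht =>
          (h.bddMeasurable_coarseError p (mem_Icc.1 ht).1).integrable (h.playHistory_le _))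
          (hweight.add hfeedback) ?_
        filter_upwards [h.ae_norm_feedback_le, h.init_le] with ω hM hR
        exact sum_coarseError_le h.q_le_half hM hR p T
    _ = κ * ∫ ω, ∑ i, wt T i ω ∂μ + 2 * ∫ ω, feedbackEnergy q fb T ω ∂μ := by
        rw [integral_add hweight hfeedback, integral_const_mul, integral_const_mul]
    _ ≤ κ * C + 2 * ((1 + σM ^ 2) * C) := by
        gcongr
        · exact (hC T).2
        · exact (h.integral_feedbackEnergy_le T).trans (by gcongr; exact (hC T).1)

theorem ae_exists_tendsto_sum_weightedDist (h : NoisyRun μ ℓ L σM G B q R ξ X x)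
    (hp : IsNash ℓ p) :
    ∀ᵐ ω ∂μ, ∃ l, Tendsto (fun t => ∑ i, weightedDist fb X p t i ω) atTop (𝓝 l) := by
  obtain ⟨C, hC⟩ := h.exists_integral_sum_coarseError_le p
  have hpos : ∀ n : ℕ, 1 ≤ n + 1 := Nat.le_add_left 1
  let ℱ : Filtration ℕ m0 := ⟨fun n => playHistory x (n + 1),
    fun _ _ hab => playHistory_mono (Nat.add_le_add_right hab 1), fun n => h.playHistory_le _⟩
  have hdist : ∀ n, BddMeasurable (ℱ n) μ fun ω => ∑ i, weightedDist fb X p (n + 1) i ω :=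
    fun n => BddMeasurable.sum _ fun i _ =>
      (h.knowsUntil (hpos n)).bddMeasurable_weightedDist h.run p (hpos n) le_rfl i
  have herror : ∀ n, BddMeasurable (ℱ (n + 1)) μ (coarseError fb q X p (n + 1)) :=
    fun n => h.bddMeasurable_coarseError p (hpos n)
  have hconv := ae_tendsto_of_almost_supermartingale (μ := μ) (ℱ := ℱ)
    (u := fun n ω => ∑ i, weightedDist fb X p (n + 1) i ω)
    (b := fun n => coarseError fb q X p (n + 1))
    (fun n => (hdist n).stronglyMeasurable) (fun n => (hdist n).integrable (ℱ.le n))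
    (fun n => (herror n).stronglyMeasurable) (fun n => (herror n).integrable (ℱ.le _))
    (fun n => (h.bddMeasurable_regret p (hpos n)).integrable le_rfl)
    (fun n => h.condExp_regret_nonneg hp (hpos n))
    (fun n => ae_of_all _ fun ω => h.run.sum_weightedDist_succ_le_coarseError p (hpos n))
    (fun n ω => sum_nonneg fun i _ => weightedDist_nonneg) (fun n ω => coarseError_nonneg)
    (fun n => (integral_congr_ae (ae_of_all _ fun ω =>
      sum_range_succ_eq_sum_Icc_one (fun t => coarseError fb q X p t ω) n)).trans_le (hC n))
  filter_upwards [hconv] with ω ⟨l, hl⟩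
  exact ⟨l, (tendsto_add_atTop_iff_nat 1).1 hl⟩

theorem ae_tendsto_cumSq_pathSq (h : NoisyRun μ ℓ L σM G B q R ξ X x) :
    ∀ᵐ ω ∂μ, ∀ i, (∃ l, Tendsto (fun t => cumSq fb t i ω) atTop (𝓝 l)) ∧
      ∃ l, Tendsto (fun t => pathSq X t i ω) atTop (𝓝 l) := by
  obtain ⟨C, hC⟩ := h.exists_integral_le
  have hbdd := ae_bddAbove_of_integral_le
    (fun T => (h.bddMeasurable_sum_stepWeight T).integrable le_rfl)
    (fun T ω => sum_nonneg fun i _ => stepWeight_nonneg)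
    (fun ω _ _ hst => sum_le_sum fun i _ => stepWeight_mono hst) fun T => (hC T).2
  filter_upwards [hbdd] with ω ⟨K, hK⟩ i
  refine exists_tendsto_cumSq_and_pathSq ⟨K, Set.forall_mem_range.2 fun T => ?_⟩
  exact (single_le_sum (f := fun i => wt T i ω) (fun _ _ => stepWeight_nonneg)
    (mem_univ i)).trans (hK ⟨T, rfl⟩)

theorem ae_summable_sq_norm_indivGrad (h : NoisyRun μ ℓ L σM G B q R ξ X x) :
    ∀ᵐ ω ∂μ, ∀ i, Summable fun t => ‖indivGrad ℓ i (x t ω)‖ ^ 2 := by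
  obtain ⟨C, hC⟩ := h.exists_integral_le
  have hbdd := ae_bddAbove_of_integral_le
    (fun T => (h.bddMeasurable_gradEnergy T).integrable le_rfl)
    (fun T ω => gradEnergy_nonneg T) (fun ω => gradEnergy_mono) fun T => (hC T).1
  filter_upwards [hbdd, h.ae_tendsto_cumSq_pathSq] with ω ⟨K, hK⟩ hlim i
  obtain ⟨l, hl⟩ := (hlim i).1
  obtain ⟨γ, hγ, hγlim⟩ := exists_tendsto_extrapStep (q := q) hl
  refine (summable_nat_add_iff 1).1 (summable_of_sum_range_le (c := K / γ)
    (fun t => by positivity) fun T => ?_)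
  rw [sum_range_succ_eq_sum_Icc_one fun t => ‖indivGrad ℓ i (x t ω)‖ ^ 2, le_div_iff₀' hγ, mul_sum]
  refine (sum_le_sum fun t _ => ?_).trans (hK ⟨T, rfl⟩)
  calc γ * ‖indivGrad ℓ i (x t ω)‖ ^ 2 ≤ stepγ t i ω * ‖indivGrad ℓ i (x t ω)‖ ^ 2 := by
        gcongr
        exact (extrapStep_antitone h.q_le_half).le_of_tendsto hγlim t
    _ ≤ ∑ i, stepγ t i ω * ‖indivGrad ℓ i (x t ω)‖ ^ 2 :=
        single_le_sum (f := fun i => stepγ t i ω * ‖indivGrad ℓ i (x t ω)‖ ^ 2)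
          (fun _ _ => mul_nonneg extrapStep_pos.le (by positivity)) (mem_univ i)

theorem ae_tendsto_nash (h : NoisyRun μ ℓ L σM G B q R ξ X x) :
    ∀ᵐ ω ∂μ, ∃ z, IsNash ℓ z ∧ Tendsto (fun t => X t ω) atTop (𝓝 z) ∧
      Tendsto (fun t => x t ω) atTop (𝓝 z) := by
  obtain ⟨D, hD, hDcount, hdense⟩ := (TopologicalSpace.IsSeparable.of_separableSpace
    {p | IsNash ℓ p}).exists_countable_dense_subset
  have hdist : ∀ᵐ ω ∂μ, ∀ p ∈ D,
      ∃ l, Tendsto (fun t => ∑ i, weightedDist fb X p t i ω) atTop (𝓝 l) :=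
    (ae_ball_iff hDcount).2 fun p hp => h.ae_exists_tendsto_sum_weightedDist (hD hp)
  filter_upwards [hdist, h.ae_tendsto_cumSq_pathSq, h.ae_summable_sq_norm_indivGrad]
    with ω hdist hlim hsummable
  have hsub := h.run.tendsto_play_sub_iterate h.q_le_half fun i => (hlim i).1
  choose w hw hwlim using fun i =>
    exists_tendsto_invStep (hlim i).1.choose_spec (hlim i).2.choose_spec
  obtain ⟨z, hz, hXz⟩ := exists_tendsto_of_tendsto_sum_mul_norm_sub_sq hwlim hw
    h.stable.exists_nash hdense hdist fun z hz =>
      h.smooth.isNash_of_mapClusterPt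
        (fun i => h.smooth.tendsto_indivGrad_iterate hsub (hsummable i)) hz
  exact ⟨z, hz, hXz, by simpa only [sub_add_cancel, zero_add] using hsub.add hXz⟩

end NoisyRun

end Run

end NoisyGame

end

theorem mainTheorem5 {N : ℕ} {d : Fin N → ℕ}
    {Ω : Type*} [MeasurableSpace Ω] (μ : Measure Ω) [IsProbabilityMeasure μ]
    (ℓ : Fin N → NoisyGame.JointAction d → ℝ) (L : ℝ≥0) (σM G B q R : ℝ)
    (ξ : ℕ → (i : Fin N) → Ω → NoisyGame.Action d i)
    (X x : ℕ → Ω → NoisyGame.JointAction d)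
    (hq0 : 0 < q) (hq1 : q ≤ 1 / 4)
    (hsmooth : NoisyGame.ConvexSmooth ℓ L)
    (hstable : NoisyGame.VariationallyStable ℓ)
    (hnoise : NoisyGame.NoiseModel μ ℓ x ξ 0 σM)
    (hbdd : NoisyGame.BoundedFeedback μ ℓ ξ G B)
    (hX1 : Measurable (X 1)) (hX1_bdd : ∀ᵐ ω ∂μ, ‖X 1 ω‖ ≤ R)
    (hrun : NoisyGame.RunsAdaptiveOptDAPlus ℓ q ξ X x) :
    (∀ᵐ ω ∂μ, ∀ i : Fin N,
      (∃ l : ℝ, Tendsto (fun t => NoisyGame.cumSq (NoisyGame.feedback ℓ x ξ) t i ω)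
        atTop (𝓝 l)) ∧
      (∃ m : ℝ, Tendsto (fun t => NoisyGame.pathSq X t i ω) atTop (𝓝 m))) ∧
    (∀ᵐ ω ∂μ, ∀ i : Fin N,
      (∃ γ : ℝ, 0 < γ ∧
        Tendsto (fun t => NoisyGame.extrapStep q (NoisyGame.feedback ℓ x ξ) t i ω)
          atTop (𝓝 γ)) ∧
      (∃ η : ℝ, 0 < η ∧
        Tendsto (fun t => NoisyGame.updateStep (NoisyGame.feedback ℓ x ξ) X t i ω)
          atTop (𝓝 η))) ∧
    (∀ᵐ ω ∂μ, Summable (fun t => ‖NoisyGame.jointGrad ℓ (x t ω)‖ ^ 2)) ∧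
    (∀ᵐ ω ∂μ, ∃ xs : NoisyGame.JointAction d, NoisyGame.IsNash ℓ xs ∧
      Tendsto (fun t => X t ω) atTop (𝓝 xs) ∧ Tendsto (fun t => x t ω) atTop (𝓝 xs)) := by
  have h : NoisyGame.NoisyRun μ ℓ L σM G B q R ξ X x :=
    ⟨hq0, hq1, hsmooth, hstable, hnoise, hbdd, hX1, hX1_bdd, hrun⟩
  refine ⟨h.ae_tendsto_cumSq_pathSq, ?_, ?_, h.ae_tendsto_nash⟩
  · filter_upwards [h.ae_tendsto_cumSq_pathSq] with ω hlim i
    obtain ⟨⟨l, hl⟩, m, hm⟩ := hlim i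
    exact ⟨NoisyGame.exists_tendsto_extrapStep hl, NoisyGame.exists_tendsto_updateStep hl hm⟩
  · filter_upwards [h.ae_summable_sq_norm_indivGrad] with ω hsummable
    have hnorm : ∀ t, ‖NoisyGame.jointGrad ℓ (x t ω)‖ ^ 2 =
        ∑ i, ‖NoisyGame.indivGrad ℓ i (x t ω)‖ ^ 2 := fun t => PiLp.norm_sq_eq_of_L2 _ _
    simpa only [hnorm] using summable_sum fun i _ => hsummable i
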